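/- **Model.** For an integer $m\ge1$ and real $\delta\ge 0$ (loops and parallel edges are allowed; a loop contributes $2$ to the degree), $\mathrm{PA}_1(1,\delta)$ is one vertex $v_1$ with a loop, and $\mathrm{PA}_{n+1}(1,\delta)$ arises from $\mathrm{PA}_n(1,\delta)$ by adding a vertex $v_{n+1}$ with one edge whose other end is $v_{n+1}$ with probability $\frac{1+\delta}{n(2+\delta)+1+\delta}$ and is $v_i$ $(i\le n)$ with probability $\frac{D_i(n)+\delta}{n(2+\delta)+1+\delta}$, where $D_i(n)$ is the degree of $v_i$ in $\mathrm{PA}_n(1,\delta)$. The multigraph $\mathrm{PA}_t(m,\delta)$ on $[t]=\{1,\dots,t\}$ is obtained from $\mathrm{PA}_{mt}(1,\delta/m)$ by contracting, for each $i\in[t]$, the vertices $v_{(i-1)m+1},\dots,v_{im}$ to the vertex $i$, keeping all loops and parallel edges. In the protocol $\mathcal{MP}^k$ ($k$ odd) on a multigraph, at each time step $\tau=1,2,\dots$ each vertex $v$, independently, chooses uniformly at random a set of $\min(k,\ell_v)$ of the half-edges at $v$, where $\ell_v$ is the largest odd number not exceeding the degree of $v$, and takes as its colour at time $\tau$ the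 majority, over the chosen half-edges, of the colours at time $\tau-1$ of the vertices at their other ends. **Lemma.** Let $m\ge 5$, let $k\ge5$ be odd, and let $d=\min(m,k)$ if $m$ is odd and $d=\min(m-1,k)$ if $m$ is even. Let $\alpha^*$ be the smallest positive solution $x\in(0,1]$ of $\Pr\big(\mathrm{Bin}(d-1,x)\ge\frac{d-1}{2}\big)=x$. Let $\varepsilon>0$ and $$\tau_*=B\log_d\log_d t,\qquad B=\frac{1+\varepsilon}{\log_d\left(\frac{d-1}{2}\right)} .$$ For a constant $A$ put $\omega=A\log\log t$ and $\kappa_o=(\log t)^{999\,\omega}$. There is a constant $A_0$, depending only on $m,k,\varepsilon$, such that for every constant $A\ge A_0$, every $\delta\ge0$ and every $\alpha$ with $0\le\alpha<\alpha^*$ the following holds. Suppose that at time $0$ each vertex of $\mathrm{PA}_t(m,\delta)$ is red with probability $\alpha$ and blue otherwise, independently of each other, of the graph and of the choices of the protocol. Then, with probability tending to $1$ as $t\to\infty$, under $\mathcal{MP}^k$ every vertex $v\in[t]$ with $v>\kappa_o$ is blue at the time steps $T+1$ and $T+2$, both for $T=\lfloor\tau_*\rfloor$ and for $T=\lceil\tau_*\rceil$.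 -/

import Mathlib

open MeasureTheory ProbabilityTheory Filter Topology
open scoped NNReal ENNReal

noncomputable section

namespace MajorityPA

/-! ### Multigraphs (loops and parallel edges allowed) -/

/-- A multigraph with vertex set `V` and edges indexed by `E`; the edge `e` joins `src e` and
`tgt e` (a loop if these agree). -/
structure Multigraph (V E : Type*) where
  src : E → V
  tgt : E → V

namespace Multigraph

variable {V E : Type*}

/-- Each edge `e` consists of two half-edges `(e, false)` and `(e, true)`. `base h` is the vertex
to which the half-edge `h` is attached. -/
def base (G : Multigraph V E) (h : E × Bool) : V :=
  if h.2 then G.tgt h.1 else G.src h.1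

/-- The vertex at the other end of the edge of the half-edge `h`. -/
def tip (G : Multigraph V E) (h : E × Bool) : V :=
  if h.2 then G.src h.1 else G.tgt h.1

/-- The half-edges attached to `v`, i.e. the list of neighbours of `v` with multiplicity. -/
def halfEdgesAt [Fintype E] [DecidableEq V] (G : Multigraph V E) (v : V) : Finset (E × Bool) :=
  Finset.univ.filter fun h => G.base h = v

/-- The degree of `v`; a loop counts twice. -/
def degree [Fintype E] [DecidableEq V] (G : Multigraph V E) (v : V) : ℕ :=
  (G.halfEdgesAt v).card

/-- Contraction of vertices along `f`, keeping all loops and parallel edges. -/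
def contract {W : Type*} (G : Multigraph V E) (f : V → W) : Multigraph W E where
  src := f ∘ G.src
  tgt := f ∘ G.tgt

theorem sum_degree [Fintype V] [Fintype E] [DecidableEq V] (G : Multigraph V E) :
    ∑ v, G.degree v = 2 * Fintype.card E := by
  unfold degree halfEdgesAt
  rw [← Finset.card_eq_sum_card_fiberwise (f := G.base) (s := Finset.univ) (t := Finset.univ)
    (fun _ _ => Finset.mem_coe.2 (Finset.mem_univ _))]
  simp [mul_comm]

end Multigraph

/-! ### The preferential attachment graph -/

/-- The possible values of the graph `PA_n(1, δ)`: vertices and edges are indexed by `0, …, n - 1`,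
and the `j`-th edge joins the `j`-th vertex to the vertex `e j ≤ j`. -/
abbrev PATree (n : ℕ) : Type := (j : Fin n) → Fin (j + 1)

/-- The multigraph on `Fin n` given by the choices of end vertices. -/
def PATree.graph {n : ℕ} (e : PATree n) : Multigraph (Fin n) (Fin n) where
  src j := j
  tgt j := Fin.castLE j.isLt (e j)

/-- The probability that the new vertex (number `n + 1`, i.e. index `n`) sends its edge to the
vertex of index `i`, given the present graph `e` on `n` vertices. -/
def attachWeight (δ : ℝ≥0) {n : ℕ} (e : PATree n) (i : Fin (n + 1)) : ℝ≥0∞ :=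
  if h : (i : ℕ) < n then
    ((e.graph.degree ⟨i, h⟩ : ℝ≥0) + δ) / ((n : ℝ≥0) * (2 + δ) + (1 + δ) : ℝ≥0)
  else
    (1 + δ) / ((n : ℝ≥0) * (2 + δ) + (1 + δ) : ℝ≥0)

theorem sum_attachWeight (δ : ℝ≥0) {n : ℕ} (e : PATree n) : ∑ i, attachWeight δ e i = 1 := by
  have hs : (∑ i : Fin n, (e.graph.degree i : ℝ≥0)) = 2 * n := by
    have := e.graph.sum_degree
    rw [Fintype.card_fin] at this
    exact_mod_cast this
  rw [Fin.sum_univ_castSucc]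
  simp only [attachWeight, Fin.val_castSucc, Fin.is_lt, dite_true, Fin.val_last, lt_irrefl,
    dite_false, Fin.eta, div_eq_mul_inv, ← Finset.sum_mul, ← add_mul]
  rw [← div_eq_mul_inv]
  have hc : (∑ i : Fin n, (((e.graph.degree i : ℝ≥0) : ℝ≥0∞) + (δ : ℝ≥0∞))) + (1 + (δ : ℝ≥0∞))
      = (((n : ℝ≥0) * (2 + δ) + (1 + δ) : ℝ≥0) : ℝ≥0∞) := by
    have : (n : ℝ≥0) * (2 + δ) + (1 + δ)
        = (∑ i : Fin n, ((e.graph.degree i : ℝ≥0) + δ)) + (1 + δ) := by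
      rw [Finset.sum_add_distrib, hs]
      simp
      ring
    rw [this]
    push_cast
    rfl
  rw [hc]
  refine ENNReal.div_self ?_ ENNReal.coe_ne_top
  have : (0 : ℝ≥0) < (n : ℝ≥0) * (2 + δ) + (1 + δ) := by positivity
  exact_mod_cast this.ne'

/-- The law of the end vertex of the edge added to the graph `e`. -/
def attachLaw (δ : ℝ≥0) {n : ℕ} (e : PATree n) : PMF (Fin (n + 1)) :=
  PMF.ofFintype (attachWeight δ e) (sum_attachWeight δ e)

/-- The graph `e` with one further vertex, whose edge goes to the vertex `i`. -/
def PATree.extend {n : ℕ} (e : PATree n) (i : Fin (n + 1)) : PATree (n + 1) :=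
  Fin.snoc (α := fun j : Fin (n + 1) => Fin (j + 1)) e i

/-- The law of `PA_n(1, δ)`. The step from `0` to `1` vertices creates a single vertex with a
loop, with probability one. -/
def paTreeLaw (δ : ℝ≥0) : (n : ℕ) → PMF (PATree n)
  | 0 => PMF.pure (fun j => j.elim0)
  | n + 1 => (paTreeLaw δ n).bind fun e => (attachLaw δ e).map e.extend

/-- The graph `PA_t(m, δ)` obtained from `PA_{tm}(1, δ/m)` by contracting consecutive blocks of `m`
vertices. The vertex `v : Fin t` is the vertex number `v + 1` of `{1, …, t}`. -/
def paGraph {m t : ℕ} (e : PATree (t * m)) : Multigraph (Fin t) (Fin (t * m)) :=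
  e.graph.contract Fin.divNat

/-! ### The `k`-choice local majority protocol

Colours are Booleans: `true` is red and `false` is blue. -/

section Protocol

variable {V E : Type*} [Fintype E] [DecidableEq V]

/-- The number of neighbours polled by `v`: `k` (which is odd) if `v` has at least `k` neighbours,
and otherwise the largest odd number that is at most the degree of `v`. -/
def pollSize (G : Multigraph V E) (k : ℕ) (v : V) : ℕ :=
  min k (if Odd (G.degree v) then G.degree v else G.degree v - 1)

theorem pollSize_le (G : Multigraph V E) (k : ℕ) (v : V) :
    pollSize G k v ≤ (G.halfEdgesAt v).card := by
  refine (min_le_right _ _).trans ?_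
  split_ifs
  · exact le_rfl
  · exact Nat.sub_le _ _

/-- The law of the poll of `v`: a uniformly random set of `pollSize G k v` half-edges at `v`. -/
def pollLaw (G : Multigraph V E) (k : ℕ) (v : V) : PMF (Finset (E × Bool)) :=
  PMF.uniformOfFinset ((G.halfEdgesAt v).powersetCard (pollSize G k v))
    (Finset.powersetCard_nonempty.2 (pollSize_le G k v))

/-- The colours at each time step, for the initial colouring `X₀` and the polls `N`; `N (τ, v)`
is the poll of `v` at time step `τ ≥ 1`. -/
def colour (G : Multigraph V E) (X₀ : V → Bool) (N : ℕ × V → Finset (E × Bool)) : ℕ → V → Bool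
  | 0 => X₀
  | τ + 1 => fun v =>
      decide ((N (τ + 1, v)).card <
        2 * ((N (τ + 1, v)).filter fun h => colour G X₀ N τ (G.tip h) = true).card)

/-- The law of the initial colouring and of all polls on a given graph: each vertex is initially red
with probability `α`, and all initial colours and all polls are independent. -/
def protocolLaw [Fintype V] (G : Multigraph V E) (k : ℕ) (α : unitInterval) :
    Measure ((V → Bool) × (ℕ × V → Finset (E × Bool))) :=
  (Measure.pi fun _ : V => bernoulliMeasure true false α).prod
    (Measure.infinitePi fun p : ℕ × V => (pollLaw G k p.2).toMeasure)

instance [Fintype V] (G : Multigraph V E) (k : ℕ) (α : unitInterval) :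
    IsProbabilityMeasure (protocolLaw G k α) := by
  unfold protocolLaw
  infer_instance

end Protocol

/-- The joint law of the graph `PA_t(m, δ)`, the initial colouring and the polls. -/
def jointLaw (m k : ℕ) (δ : ℝ≥0) (α : unitInterval) (t : ℕ) :
    Measure (PATree (t * m) ×
      ((Fin t → Bool) × (ℕ × Fin t → Finset (Fin (t * m) × Bool)))) :=
  (paTreeLaw (δ / m) (t * m)).toMeasure ⊗ₘ
    Kernel.ofFunOfCountable fun e => protocolLaw (paGraph e) k α

instance (m k : ℕ) (δ : ℝ≥0) (α : unitInterval) (t : ℕ) :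
    IsProbabilityMeasure (jointLaw m k δ α t) := by
  have : IsMarkovKernel (Kernel.ofFunOfCountable
      fun e : PATree (t * m) => protocolLaw (paGraph e) k α) :=
    ⟨fun e => inferInstanceAs (IsProbabilityMeasure (protocolLaw (paGraph e) k α))⟩
  unfold jointLaw
  infer_instance

/-! ### Parameters -/

/-- `d = m ∧ k` for odd `m` and `d = (m - 1) ∧ k` for even `m`. -/
def dParam (m k : ℕ) : ℕ := if Odd m then min m k else min (m - 1) k

/-- The smallest positive solution `x` of `P(Bin(d - 1, x) ≥ (d - 1) / 2) = x`. -/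
def alphaStar (d : ℕ) : ℝ :=
  sInf {x : ℝ | ∃ p : unitInterval, (p : ℝ) = x ∧ 0 < x ∧
    (binomial (d - 1) p).real {j : ℕ | ((d : ℝ) - 1) / 2 ≤ (j : ℝ)} = x}

/-- `τ_* = B log_d log_d t` with `B = (1 + ε) / log_d((d - 1) / 2)`. -/
def tauStar (d : ℕ) (ε : ℝ) (t : ℕ) : ℝ :=
  (1 + ε) / Real.logb d (((d : ℝ) - 1) / 2) * Real.logb d (Real.logb d t)

/-- `ω = A log log t`. -/
def omega (A : ℝ) (t : ℕ) : ℝ := A * Real.log (Real.log t)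

/-- `κ_o = (log t)^(999 ω)`; the outer core consists of the vertices with number at most `κ_o`. -/
def kappaO (A : ℝ) (t : ℕ) : ℝ := Real.log t ^ (999 * omega A t)

/-- All vertices outside the outer core are blue at time step `τ`. -/
def BlueOutsideCore {m t : ℕ} (A : ℝ) (e : PATree (t * m)) (X₀ : Fin t → Bool)
    (N : ℕ × Fin t → Finset (Fin (t * m) × Bool)) (τ : ℕ) : Prop :=
  ∀ v : Fin t, kappaO A t < (v : ℕ) + 1 → colour (paGraph e) X₀ N τ v = false

end MajorityPA

end

noncomputable section

namespace MajorityPA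

/-!
A half-edge leads to red only along walks from it. While these walks form a tree, the colours that
they carry to a vertex are independent, up to counting the parent of each vertex as red, so that
the probability of red is dominated by the iterates of `p ↦ P(Bin(2h, p) ≥ h)`, `d = 2h + 1`,
started from `α`. Below the fixed point `α^*` they tend to zero, eventually at the rate
`exp(-h ^ s)`, which for `s` close to `τ_*` is much smaller than `1 / t`; thus at these time steps
no half-edge with a tree-like neighbourhood leads to red.

Suppose that three half-edges at `v` have neighbourhoods that are not tree-like. Then `O(log log t)`
edges form a graph without leaves in which `v` has degree at least three. Given edges join `i` to
`j` with probability at most `∏ 1 / √(ij)`, up to powers of `log t` of order `log log t`, so that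
every vertex `x` of such a graph contributes a factor at most `1 / x`, whose sum over `x` is
`O(log t)`, and the excess degree of `v > κ_o` contributes a further `κ_o ^ (-1 / 2)`, which beats
all these powers of `log t`. Hence at most two half-edges at a vertex outside the outer core lead
to red, and a majority of the at least five polled ones leads to blue.
-/
/-! ### Binomial tails -/

/-- The probability that a binomial variable with parameters `n` and `p` is at least `a`, computed
by conditioning on the first trial. It is a polynomial in `p`, so `p` may be any real number. -/
def binTail : ℕ → ℕ → ℝ → ℝ
  | _, 0, _ => 1
  | 0, _ + 1, _ => 0
  | n + 1, a + 1, p => p * binTail n a p + (1 - p) * binTail n (a + 1) p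

@[simp] theorem binTail_zero_right (n : ℕ) (p : ℝ) : binTail n 0 p = 1 := by
  cases n <;> rfl

@[simp] theorem binTail_zero_succ (a : ℕ) (p : ℝ) : binTail 0 (a + 1) p = 0 := rfl

theorem binTail_succ_succ (n a : ℕ) (p : ℝ) :
    binTail (n + 1) (a + 1) p = p * binTail n a p + (1 - p) * binTail n (a + 1) p := rfl

theorem binTail_nonneg {p : ℝ} (h0 : 0 ≤ p) (h1 : p ≤ 1) (n a : ℕ) : 0 ≤ binTail n a p := by
  induction n generalizing a with
  | zero => cases a <;> simp
  | succ n ih =>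
    cases a with
    | zero => simp
    | succ a =>
      rw [binTail_succ_succ]
      exact add_nonneg (mul_nonneg h0 (ih a)) (mul_nonneg (sub_nonneg.2 h1) (ih (a + 1)))

theorem binTail_sub_succ (n a : ℕ) (p : ℝ) :
    binTail n a p - binTail n (a + 1) p = n.choose a * p ^ a * (1 - p) ^ (n - a) := by
  induction n generalizing a with
  | zero => cases a <;> simp
  | succ n ih =>
    cases a with
    | zero =>
      have first := ih 0
      simp only [binTail_zero_right, Nat.choose_zero_right, binTail_succ_succ, Nat.sub_zero,
        pow_zero, Nat.cast_one, mul_one, one_mul] at first ⊢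
      rw [pow_succ', ← first]
      ring
    | succ a =>
      calc binTail (n + 1) (a + 1) p - binTail (n + 1) (a + 1 + 1) p
          = p * (binTail n a p - binTail n (a + 1) p)
            + (1 - p) * (binTail n (a + 1) p - binTail n (a + 1 + 1) p) := by
            rw [binTail_succ_succ, binTail_succ_succ]
            ring
        _ = p * (n.choose a * p ^ a * (1 - p) ^ (n - a))
            + (1 - p) * (n.choose (a + 1) * p ^ (a + 1) * (1 - p) ^ (n - (a + 1))) := by
            rw [ih a, ih (a + 1)]
        _ = (n + 1).choose (a + 1) * p ^ (a + 1) * (1 - p) ^ (n + 1 - (a + 1)) := by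
            rw [Nat.choose_succ_succ, Nat.add_sub_add_right, Nat.cast_add]
            rcases lt_or_ge a n with h | h
            · obtain ⟨b, rfl⟩ := Nat.exists_eq_add_of_lt h
              rw [show a + b + 1 - a = b + 1 by omega, show a + b + 1 - (a + 1) = b by omega]
              ring
            · rw [Nat.choose_eq_zero_of_lt (show n < a + 1 by omega), Nat.cast_zero]
              ring

theorem binTail_succ_right_le {p : ℝ} (h0 : 0 ≤ p) (h1 : p ≤ 1) (n a : ℕ) :
    binTail n (a + 1) p ≤ binTail n a p := by
  have : 0 ≤ 1 - p := sub_nonneg.2 h1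
  rw [← sub_nonneg, binTail_sub_succ]
  positivity

theorem binTail_eq_zero {n a : ℕ} (h : n < a) (p : ℝ) : binTail n a p = 0 := by
  induction n generalizing a with
  | zero => obtain ⟨a, rfl⟩ := Nat.exists_eq_succ_of_ne_zero h.ne'; rfl
  | succ n ih =>
    obtain ⟨a, rfl⟩ := Nat.exists_eq_succ_of_ne_zero (Nat.ne_zero_of_lt h)
    rw [binTail_succ_succ, ih (by omega), ih (by omega), mul_zero, mul_zero, add_zero]

theorem binomial_real_ge_eq_binTail (n a : ℕ) (p : unitInterval) :
    (binomial n p).real {j : ℕ | a ≤ j} = binTail n a p := by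
  induction a with
  | zero => simp
  | succ a ih =>
    have hs : {j : ℕ | a + 1 ≤ j} = {j : ℕ | a ≤ j} \ {a} := by
      ext j
      simp only [Set.mem_ofPred_eq, Set.mem_sdiff, Set.mem_singleton_iff]
      omega
    rw [hs, measureReal_sdiff (by simp) (by simp), ih, binomial_real_singleton,
      ← binTail_sub_succ]
    ring

theorem continuous_binTail (n a : ℕ) : Continuous (binTail n a) := by
  induction n generalizing a with
  | zero =>
    cases a with
    | zero => exact continuous_const (y := (1 : ℝ))
    | succ a => exact continuous_const (y := (0 : ℝ))
  | succ n ih =>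
    cases a with
    | zero => exact continuous_const (y := (1 : ℝ))
    | succ a =>
      exact (continuous_id.mul (ih a)).add
        ((continuous_const.sub continuous_id).mul (ih (a + 1)))

theorem binTail_le_two_pow_mul {p : ℝ} (h0 : 0 ≤ p) (h1 : p ≤ 1) (n a : ℕ) :
    binTail n a p ≤ 2 ^ n * p ^ a := by
  induction n generalizing a with
  | zero => cases a <;> simp [h0]
  | succ n ih =>
    cases a with
    | zero => simpa using one_le_pow₀ (n := n + 1) (one_le_two (α := ℝ))
    | succ a =>
      have := binTail_nonneg h0 h1 n (a + 1)
      calc binTail (n + 1) (a + 1) p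
          ≤ p * binTail n a p + 1 * binTail n (a + 1) p := by
            rw [binTail_succ_succ]
            gcongr
            linarith
        _ ≤ p * (2 ^ n * p ^ a) + 1 * (2 ^ n * p ^ (a + 1)) := by gcongr <;> exact ih _
        _ = 2 ^ (n + 1) * p ^ (a + 1) := by ring

theorem binTail_add_binTail_compl {n a b : ℕ} (h : a + b = n + 1) (p : ℝ) :
    binTail n a p + binTail n b (1 - p) = 1 := by
  induction n generalizing a b with
  | zero =>
    obtain ⟨rfl, rfl⟩ | ⟨rfl, rfl⟩ : (a = 0 ∧ b = 1) ∨ (a = 1 ∧ b = 0) := by omega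
    all_goals simp
  | succ n ih =>
    cases a with
    | zero => rw [binTail_eq_zero (show n + 1 < b by omega), binTail_zero_right, add_zero]
    | succ a =>
      cases b with
      | zero => rw [binTail_eq_zero (show n + 1 < a + 1 by omega), binTail_zero_right, zero_add]
      | succ b =>
        have success := ih (a := a) (b := b + 1) (by omega)
        have failure := ih (a := a + 1) (b := b) (by omega)
        rw [binTail_succ_succ, binTail_succ_succ]
        linear_combination p * success + (1 - p) * failure

/-! ### The majority recursion and its threshold -/

/-- The probability that at least half of `2h` independent voters, each red with probability `p`,
are red. A vertex polling `2h + 1` half-edges, one of which is taken to be red, turns red with this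
probability. -/
def majorityMap (h : ℕ) (p : ℝ) : ℝ := binTail (2 * h) h p

theorem continuous_majorityMap (h : ℕ) : Continuous (majorityMap h) := continuous_binTail _ _

theorem majorityMap_nonneg {p : ℝ} (h0 : 0 ≤ p) (h1 : p ≤ 1) (h : ℕ) : 0 ≤ majorityMap h p :=
  binTail_nonneg h0 h1 _ _

theorem majorityMap_le_four_pow_mul {p : ℝ} (h0 : 0 ≤ p) (h1 : p ≤ 1) (h : ℕ) :
    majorityMap h p ≤ 4 ^ h * p ^ h :=
  (binTail_le_two_pow_mul h0 h1 _ _).trans_eq (by rw [pow_mul]; norm_num)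

theorem half_le_majorityMap_half (h : ℕ) : 1 / 2 ≤ majorityMap h (1 / 2) := by
  have compl := binTail_add_binTail_compl (n := 2 * h) (a := h) (b := h + 1) (by omega) (1 / 2)
  have anti := binTail_succ_right_le (p := 1 / 2) (by norm_num) (by norm_num) (2 * h) h
  rw [show (1 - 1 / 2 : ℝ) = 1 / 2 by norm_num] at compl
  rw [majorityMap]
  linarith

theorem majorityMap_succ_le {p : ℝ} (h0 : 0 ≤ p) (h1 : p ≤ 1 / 2) (h : ℕ) :
    majorityMap (h + 1) p ≤ majorityMap h p := by
  unfold majorityMap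
  cases h with
  | zero => simpa using binTail_succ_right_le h0 (by linarith) 2 0
  | succ a =>
    set n := 2 * (a + 1)
    have hq : 0 ≤ 1 - p := by linarith
    have hpq : p ≤ 1 - p := by linarith
    have choose_le : ((n.choose a : ℕ) : ℝ) ≤ (n.choose (a + 1) : ℕ) :=
      Nat.cast_le.2 (Nat.choose_le_centralBinom a (a + 1))
    -- Two more voters change the outcome only if both agree and the vote was a near tie.
    have near_tie : p ^ 2 * (binTail n a p - binTail n (a + 1) p)
        ≤ (1 - p) ^ 2 * (binTail n (a + 1) p - binTail n (a + 1 + 1) p) := by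
      rw [binTail_sub_succ, binTail_sub_succ, show n - a = a + 2 by omega,
        show n - (a + 1) = a + 1 by omega]
      calc p ^ 2 * (n.choose a * p ^ a * (1 - p) ^ (a + 2))
          = n.choose a * p * (p ^ (a + 1) * (1 - p) ^ (a + 2)) := by ring
        _ ≤ n.choose (a + 1) * (1 - p) * (p ^ (a + 1) * (1 - p) ^ (a + 2)) := by gcongr
        _ = (1 - p) ^ 2 * (n.choose (a + 1) * p ^ (a + 1) * (1 - p) ^ (a + 1)) := by ring
    rw [show 2 * (a + 1 + 1) = n + 1 + 1 by omega, binTail_succ_succ (n + 1),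
      binTail_succ_succ n a, binTail_succ_succ n (a + 1)]
    linarith

theorem majorityMap_antitone {p : ℝ} (h0 : 0 ≤ p) (h1 : p ≤ 1 / 2) :
    Antitone fun h => majorityMap h p :=
  antitone_nat_of_succ_le fun h => majorityMap_succ_le h0 h1 h

theorem alphaStar_eq (h : ℕ) :
    alphaStar (2 * h + 1) = sInf {x : ℝ | 0 < x ∧ x ≤ 1 ∧ majorityMap h x = x} := by
  have tail_eq : {j : ℕ | (((2 * h + 1 : ℕ) : ℝ) - 1) / 2 ≤ (j : ℝ)} = {j : ℕ | h ≤ j} := by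
    ext j
    simp only [Set.mem_ofPred_eq]
    rw [← Nat.cast_le (α := ℝ)]
    push_cast
    constructor <;> intro <;> linarith
  unfold alphaStar
  congr 1
  ext x
  simp only [Set.mem_ofPred_eq, tail_eq, Nat.add_sub_cancel, binomial_real_ge_eq_binTail]
  constructor
  · rintro ⟨p, rfl, h0, hfix⟩
    exact ⟨h0, p.2.2, hfix⟩
  · rintro ⟨h0, h1, hfix⟩
    exact ⟨⟨x, h0.le, h1⟩, rfl, h0, hfix⟩

theorem majorityMap_le_self_of_le {h : ℕ} (hh : 2 ≤ h) {p : ℝ} (h0 : 0 ≤ p)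
    (hp : p ≤ (4 ^ h)⁻¹) : majorityMap h p ≤ p := by
  have h1 : p ≤ 1 := hp.trans (inv_le_one_of_one_le₀ (one_le_pow₀ (by norm_num)))
  calc majorityMap h p ≤ 4 ^ h * p ^ h := majorityMap_le_four_pow_mul h0 h1 h
    _ ≤ 4 ^ h * p ^ 2 := by
        gcongr 4 ^ h * ?_
        exact pow_le_pow_of_le_one h0 h1 hh
    _ ≤ 4 ^ h * ((4 ^ h)⁻¹ * p) := by
        rw [sq]
        gcongr
    _ = p := by rw [mul_inv_cancel_left₀ (by positivity)]

theorem exists_fixed_majorityMap_le {h : ℕ} (hh : 2 ≤ h) {p : ℝ} (h0 : 0 < p)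
    (hp : p ≤ majorityMap h p) : ∃ x, 0 < x ∧ x ≤ p ∧ majorityMap h x = x := by
  set y : ℝ := min p (4 ^ h)⁻¹
  have hy : 0 < y := lt_min h0 (by positivity)
  have hc : ContinuousOn (fun x => majorityMap h x - x) (Set.Icc y p) :=
    ((continuous_majorityMap h).sub continuous_id).continuousOn
  obtain ⟨x, hx, hfix⟩ := intermediate_value_Icc (min_le_left p _) hc
    ⟨sub_nonpos.2 (majorityMap_le_self_of_le hh hy.le (min_le_right _ _)), sub_nonneg.2 hp⟩
  exact ⟨x, hy.trans_le hx.1, hx.2, sub_eq_zero.1 hfix⟩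

theorem alphaStar_le {h : ℕ} (hh : 2 ≤ h) {p : ℝ} (h0 : 0 < p) (h1 : p ≤ 1)
    (hp : p ≤ majorityMap h p) : alphaStar (2 * h + 1) ≤ p := by
  obtain ⟨x, hx, hxp, hfix⟩ := exists_fixed_majorityMap_le hh h0 hp
  rw [alphaStar_eq]
  exact csInf_le_of_le ⟨0, fun y hy => hy.1.le⟩ ⟨hx, hxp.trans h1, hfix⟩ hxp

theorem alphaStar_le_half {h : ℕ} (hh : 2 ≤ h) : alphaStar (2 * h + 1) ≤ 1 / 2 :=
  alphaStar_le hh (by norm_num) (by norm_num) (half_le_majorityMap_half h)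

theorem majorityMap_le_self {h : ℕ} (hh : 2 ≤ h) {p : ℝ} (h0 : 0 ≤ p)
    (hp : p < alphaStar (2 * h + 1)) : majorityMap h p ≤ p := by
  have hhalf := alphaStar_le_half hh
  rcases h0.eq_or_lt with rfl | h0
  · exact majorityMap_le_self_of_le hh le_rfl (by positivity)
  · by_contra! hlt
    exact (alphaStar_le hh h0 (by linarith) hlt.le).not_gt hp

/-- The iterates of `majorityMap h` started from `α`: `redSeq h α s` bounds the probability that
a half-edge whose neighbourhood of depth `s` is a tree delivers the colour red at time `s`. -/
def redSeq (h : ℕ) (α : ℝ) : ℕ → ℝ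
  | 0 => α
  | s + 1 => majorityMap h (redSeq h α s)

section redSeq

variable {h : ℕ} {α : ℝ}

theorem redSeq_mem_Icc (hh : 2 ≤ h) (h0 : 0 ≤ α) (hα : α < alphaStar (2 * h + 1)) (s : ℕ) :
    redSeq h α s ∈ Set.Icc 0 α := by
  have hhalf := alphaStar_le_half hh
  induction s with
  | zero => exact ⟨h0, le_rfl⟩
  | succ s ih =>
    exact ⟨majorityMap_nonneg ih.1 (by linarith [ih.2]) h,
      (majorityMap_le_self hh ih.1 (ih.2.trans_lt hα)).trans ih.2⟩

theorem redSeq_le_half (hh : 2 ≤ h) (h0 : 0 ≤ α) (hα : α < alphaStar (2 * h + 1)) (s : ℕ) :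
    redSeq h α s ≤ 1 / 2 := by
  linarith [alphaStar_le_half hh, (redSeq_mem_Icc hh h0 hα s).2]

theorem redSeq_antitone (hh : 2 ≤ h) (h0 : 0 ≤ α) (hα : α < alphaStar (2 * h + 1)) :
    Antitone (redSeq h α) :=
  antitone_nat_of_succ_le fun s =>
    majorityMap_le_self hh (redSeq_mem_Icc hh h0 hα s).1
      ((redSeq_mem_Icc hh h0 hα s).2.trans_lt hα)

theorem tendsto_redSeq (hh : 2 ≤ h) (h0 : 0 ≤ α) (hα : α < alphaStar (2 * h + 1)) :
    Tendsto (redSeq h α) atTop (𝓝 0) := by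
  have hb : BddBelow (Set.range (redSeq h α)) :=
    ⟨0, Set.forall_mem_range.2 fun s => (redSeq_mem_Icc hh h0 hα s).1⟩
  have hlim := tendsto_atTop_ciInf (redSeq_antitone hh h0 hα) hb
  set l := ⨅ s, redSeq h α s
  have hl0 : 0 ≤ l := le_ciInf fun s => (redSeq_mem_Icc hh h0 hα s).1
  have hlα : l ≤ α := ciInf_le hb 0
  have hfix : majorityMap h l = l :=
    tendsto_nhds_unique (((continuous_majorityMap h).tendsto l).comp hlim)
      ((tendsto_add_atTop_iff_nat 1).2 hlim)
  rcases hl0.eq_or_lt with hl | hl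
  · rwa [← hl] at hlim
  · linarith [alphaStar_le_half hh, alphaStar_le hh hl (by linarith [alphaStar_le_half hh]) hfix.ge]

theorem exists_redSeq_le_exp (hh : 2 ≤ h) (h0 : 0 ≤ α) (hα : α < alphaStar (2 * h + 1)) :
    ∃ s₀ : ℕ, ∀ s, redSeq h α (s₀ + s) ≤ Real.exp (-(h : ℝ) ^ s) := by
  obtain ⟨s₀, hs₀⟩ : ∃ s₀, redSeq h α s₀ < (4 ^ h)⁻¹ * Real.exp (-1) :=
    ((tendsto_redSeq hh h0 hα).eventually_lt_const (by positivity)).exists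
  have hC : (1 : ℝ) ≤ 4 ^ h := one_le_pow₀ (by norm_num)
  -- The factor `4 ^ h` absorbs the constant lost at each step, as `h ≥ 2`.
  have scaled (s : ℕ) : 4 ^ h * redSeq h α (s₀ + s) ≤ Real.exp (-(h : ℝ) ^ s) := by
    induction s with
    | zero => simpa using ((lt_inv_mul_iff₀ (by positivity)).1 hs₀).le
    | succ s ih =>
      have hmem := redSeq_mem_Icc hh h0 hα (s₀ + s)
      have hnonneg : 0 ≤ redSeq h α (s₀ + s) := hmem.1
      have hhalf := redSeq_le_half hh h0 hα (s₀ + s)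
      calc 4 ^ h * redSeq h α (s₀ + (s + 1))
          ≤ 4 ^ h * (4 ^ h * redSeq h α (s₀ + s) ^ h) := by
            gcongr
            exact majorityMap_le_four_pow_mul hnonneg (by linarith) h
        _ = (4 ^ h) ^ 2 * redSeq h α (s₀ + s) ^ h := by ring
        _ ≤ (4 ^ h) ^ h * redSeq h α (s₀ + s) ^ h := by gcongr
        _ = (4 ^ h * redSeq h α (s₀ + s)) ^ h := by rw [mul_pow]
        _ ≤ Real.exp (-(h : ℝ) ^ s) ^ h := by gcongr
        _ = Real.exp (-(h : ℝ) ^ (s + 1)) := by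
            rw [← Real.exp_nat_mul]
            congr 1
            ring
  exact ⟨s₀, fun s => (le_mul_of_one_le_left (redSeq_mem_Icc hh h0 hα _).1 hC).trans (scaled s)⟩

end redSeq

/-! ### Nonbacktracking walks -/

namespace Multigraph

variable {V E : Type*} {G : Multigraph V E}

/-- The other half of the edge of `h`. -/
def rev (h : E × Bool) : E × Bool := (h.1, !h.2)

@[simp] theorem rev_rev (h : E × Bool) : rev (rev h) = h := by simp [rev]

@[simp] theorem rev_fst (h : E × Bool) : (rev h).1 = h.1 := rfl

theorem rev_injective : Function.Injective (rev : E × Bool → E × Bool) :=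
  Function.LeftInverse.injective rev_rev

@[simp] theorem base_rev (G : Multigraph V E) (h : E × Bool) : G.base (rev h) = G.tip h := by
  rcases h with ⟨e, _ | _⟩ <;> rfl

/-- `h'` is a possible continuation of `h` in a nonbacktracking walk. -/
def Follows (G : Multigraph V E) (h h' : E × Bool) : Prop :=
  G.base h' = G.tip h ∧ h' ≠ rev h

/-- The nonbacktracking walks that start with the half-edge `h`; the last step is the head of
the list. -/
inductive NBWalk (G : Multigraph V E) (h : E × Bool) : List (E × Bool) → Prop
  | single : NBWalk G h [h]
  | cons {g g' : E × Bool} {l : List (E × Bool)} :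
      NBWalk G h (g :: l) → G.Follows g g' → NBWalk G h (g' :: g :: l)

theorem NBWalk.append {h h' : E × Bool} {l : List (E × Bool)} (hw : G.NBWalk h' l)
    (hf : G.Follows h h') : G.NBWalk h (l ++ [h]) := by
  induction hw with
  | single => exact .cons .single hf
  | cons _ hf' ih => exact .cons ih hf'

theorem NBWalk.getLast?_eq {h : E × Bool} {l : List (E × Bool)} (hw : G.NBWalk h l) :
    l.getLast? = some h := by
  induction hw with
  | single => rfl
  | cons _ _ ih => rwa [List.getLast?_cons_cons]

/-- The half-edge `h` starts a tree of depth `L`: nonbacktracking walks of length at most `L` that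
start with `h` are determined by their end vertices. -/
def TreeLike (G : Multigraph V E) (L : ℕ) (h : E × Bool) : Prop :=
  ∀ ⦃g g' : E × Bool⦄ ⦃l l' : List (E × Bool)⦄, G.NBWalk h (g :: l) → G.NBWalk h (g' :: l') →
    l.length < L → l'.length < L → G.tip g = G.tip g' → g :: l = g' :: l'

/-- The end vertices of the nonbacktracking walks of length at most `s + 1` that start
with `h`. -/
def reach (G : Multigraph V E) (s : ℕ) (h : E × Bool) : Set V :=
  {u | ∃ g l, G.NBWalk h (g :: l) ∧ l.length ≤ s ∧ G.tip g = u}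

theorem tip_mem_reach (s : ℕ) (h : E × Bool) : G.tip h ∈ G.reach s h :=
  ⟨h, [], .single, Nat.zero_le s, rfl⟩

theorem Follows.reach_subset {s : ℕ} {h h' : E × Bool} (hf : G.Follows h h') :
    G.reach s h' ⊆ G.reach (s + 1) h := by
  rintro u ⟨g, l, hw, hl, rfl⟩
  exact ⟨g, l ++ [h], hw.append hf, by simpa using hl, rfl⟩

namespace TreeLike

variable {L s : ℕ} {h h' : E × Bool}

theorem of_follows (ht : G.TreeLike (L + 1) h) (hf : G.Follows h h') : G.TreeLike L h' := by
  intro g g' l l' hw hw' hl hl' htip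
  have := ht (hw.append hf) (hw'.append hf) (by simpa using hl) (by simpa using hl') htip
  exact List.append_left_injective [h] this

theorem mono {L' : ℕ} (ht : G.TreeLike L h) (hL : L' ≤ L) : G.TreeLike L' h :=
  fun _ _ _ _ hw hw' hl hl' htip => ht hw hw' (by omega) (by omega) htip

theorem tip_notMem_reach (ht : G.TreeLike (s + 2) h) (hf : G.Follows h h') :
    G.tip h ∉ G.reach s h' := by
  rintro ⟨g, l, hw, hl, htip⟩
  have := ht (hw.append hf) .single (by simp; omega) (by simp) htip
  simp at this

theorem disjoint_reach {h₁ h₂ : E × Bool} (ht : G.TreeLike (s + 2) h) (hf₁ : G.Follows h h₁)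
    (hf₂ : G.Follows h h₂) (hne : h₁ ≠ h₂) : Disjoint (G.reach s h₁) (G.reach s h₂) := by
  rw [Set.disjoint_left]
  rintro _ ⟨g₁, l₁, hw₁, hl₁, rfl⟩ ⟨g₂, l₂, hw₂, hl₂, htip⟩
  have walk_eq : g₁ :: l₁ = g₂ :: l₂ := List.append_left_injective [h] <|
    ht (hw₁.append hf₁) (hw₂.append hf₂) (by simp; omega) (by simp; omega) htip.symm
  have last_eq : some h₁ = some h₂ := by rw [← hw₁.getLast?_eq, walk_eq, hw₂.getLast?_eq]
  exact hne (Option.some.inj last_eq)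

end TreeLike

end Multigraph

open Multigraph

/-! ### Counting independent events -/

section Counting

variable {Ω ι κ : Type*}

theorem measurableSet_le_card_filter {mΩ : MeasurableSpace Ω} {S : Finset ι} {A : ι → Set Ω}
    [∀ i ω, Decidable (ω ∈ A i)] (hA : ∀ i ∈ S, MeasurableSet (A i)) (a : ℕ) :
    MeasurableSet {ω | a ≤ (S.filter fun i => ω ∈ A i).card} := by
  simp only [Finset.card_filter]
  exact measurableSet_le measurable_const <| Finset.measurable_fun_sum S fun i hi =>
    Measurable.ite (hA i hi) measurable_const measurable_const

theorem setOf_le_card_filter_insert_subset [DecidableEq ι] {S : Finset ι} {j : ι} (hj : j ∉ S)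
    (A : ι → Set Ω) [∀ i ω, Decidable (ω ∈ A i)] (a : ℕ) :
    {ω | a + 1 ≤ ((insert j S).filter fun i => ω ∈ A i).card} ⊆
      A j ∩ {ω | a ≤ (S.filter fun i => ω ∈ A i).card} ∪
        (A j)ᶜ ∩ {ω | a + 1 ≤ (S.filter fun i => ω ∈ A i).card} := by
  intro ω hω
  rw [Set.mem_ofPred_eq, Finset.filter_insert] at hω
  by_cases hωj : ω ∈ A j
  · rw [if_pos hωj, Finset.card_insert_of_notMem (by simp [hj])] at hω
    exact Or.inl ⟨hωj, Nat.le_of_succ_le_succ hω⟩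
  · rw [if_neg hωj] at hω
    exact Or.inr ⟨hωj, hω⟩

variable {mΩ : MeasurableSpace Ω} {μ : Measure Ω} {m : κ → MeasurableSpace Ω}

theorem measureReal_le_card_filter_le_binTail (hm : ∀ v, m v ≤ mΩ) (hind : iIndep m μ)
    {A : ι → Set Ω} [∀ i ω, Decidable (ω ∈ A i)] {U : ι → Set κ} {S : Finset ι}
    (hA : ∀ i ∈ S, MeasurableSet[⨆ v ∈ U i, m v] (A i)) (hU : (S : Set ι).PairwiseDisjoint U)
    {p : ℝ} (hp : ∀ i ∈ S, μ.real (A i) ≤ p) (h1 : p ≤ 1) (a : ℕ) :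
    μ.real {ω | a ≤ (S.filter fun i => ω ∈ A i).card} ≤ binTail S.card a p := by
  classical
  have := hind.isProbabilityMeasure
  induction S using Finset.induction_on generalizing a with
  | empty => cases a <;> simp
  | insert j S hj ih =>
    rcases a with _ | a
    · simp
    have hjS : j ∈ insert j S := Finset.mem_insert_self j S
    specialize ih (fun i hi => hA i (Finset.mem_insert_of_mem hi)) (hU.subset (by simp))
      fun i hi => hp i (Finset.mem_insert_of_mem hi)
    set C : ℕ → Set Ω := fun b => {ω | b ≤ (S.filter fun i => ω ∈ A i).card}
    have indep : Indep (⨆ v ∈ U j, m v) (⨆ v ∈ ⋃ i ∈ S, U i, m v) μ := by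
      refine indep_iSup_of_disjoint hm hind (Set.disjoint_iUnion₂_right.2 fun i hi => ?_)
      exact hU (by simp) (by simp [hi]) (by rintro rfl; exact hj hi)
    have hC (b : ℕ) : MeasurableSet[⨆ v ∈ ⋃ i ∈ S, U i, m v] (C b) := by
      refine measurableSet_le_card_filter (mΩ := ⨆ v ∈ ⋃ i ∈ S, U i, m v) (fun i hi => ?_) b
      have le : ⨆ v ∈ U i, m v ≤ ⨆ v ∈ ⋃ i ∈ S, U i, m v :=
        biSup_mono fun v hv => Set.mem_biUnion hi hv
      exact le _ (hA i (Finset.mem_insert_of_mem hi))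
    have hCanti : μ.real (C (a + 1)) ≤ μ.real (C a) :=
      measureReal_mono fun ω (hω : a + 1 ≤ _) => (Nat.le_succ a).trans hω
    have hpj := hp j hjS
    have h0 : 0 ≤ p := measureReal_nonneg.trans hpj
    have hq : 0 ≤ 1 - p := sub_nonneg.2 h1
    calc μ.real {ω | a + 1 ≤ ((insert j S).filter fun i => ω ∈ A i).card}
        ≤ μ.real (A j ∩ C a) + μ.real ((A j)ᶜ ∩ C (a + 1)) :=
          (measureReal_mono (setOf_le_card_filter_insert_subset hj A a)).trans
            (measureReal_union_le _ _)
      _ = μ.real (A j) * μ.real (C a) + (1 - μ.real (A j)) * μ.real (C (a + 1)) := by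
          rw [← probReal_compl_eq_one_sub (iSup₂_le (fun v _ => hm v) _ (hA j hjS))]
          rw [Indep_iff] at indep
          simp only [measureReal_def, ← ENNReal.toReal_mul,
            indep _ _ (hA j hjS) (hC a), indep _ _ (hA j hjS).compl (hC (a + 1))]
      _ ≤ p * μ.real (C a) + (1 - p) * μ.real (C (a + 1)) := by nlinarith
      _ ≤ p * binTail S.card a p + (1 - p) * binTail S.card (a + 1) p := by
          gcongr <;> exact ih _
      _ = binTail (insert j S).card (a + 1) p := by
          rw [Finset.card_insert_of_notMem hj, binTail_succ_succ]

end Counting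

/-! ### The colour of a vertex one of whose neighbours is red -/

section Guarded

variable {V E : Type*}

/-- The outcomes of the protocol: the initial colours, and the poll of `v` at time step `τ` for
each pair `(τ, v)`. -/
abbrev Sample (V E : Type*) : Type _ := (V → Bool) × (ℕ × V → Finset (E × Bool))

open Classical in
/-- An upper bound for the colour of the tip of `h`: the colour that it has if the base of `h` is
always red, and likewise for its neighbours. -/
def guardedColour (G : Multigraph V E) (ω : Sample V E) : ℕ → E × Bool → Bool
  | 0, h => ω.1 (G.tip h)
  | s + 1, h => decide ((ω.2 (s + 1, G.tip h)).card <
      2 * ((ω.2 (s + 1, G.tip h)).filter fun h' =>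
        G.Follows h h' → guardedColour G ω s h' = true).card)

theorem guardedColour_of_colour {G : Multigraph V E} {ω : Sample V E} {s : ℕ} {h : E × Bool}
    (hc : colour G ω.1 ω.2 s (G.tip h) = true) : guardedColour G ω s h = true := by
  classical
  induction s generalizing h with
  | zero => exact hc
  | succ s ih =>
    simp only [colour, decide_eq_true_eq] at hc
    simp only [guardedColour, decide_eq_true_eq]
    refine hc.trans_le ?_
    gcongr 2 * Finset.card ?_
    exact Finset.monotone_filter_right _ fun h' _ hh' _ => ih hh'

/-- All the randomness at the vertex `v`: its initial colour and its polls. -/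
def vertexData (v : V) (ω : Sample V E) : Bool × (ℕ → Finset (E × Bool)) :=
  (ω.1 v, fun τ => ω.2 (τ, v))

theorem measurable_vertexData (v : V) : Measurable (vertexData v : Sample V E → _) := by
  unfold vertexData
  fun_prop

/-- The events that depend only on the randomness at the vertices in `U`. -/
abbrev localAlgebra (E : Type*) (U : Set V) : MeasurableSpace (Sample V E) :=
  ⨆ v ∈ U, MeasurableSpace.comap (vertexData v) inferInstance

theorem localAlgebra_le (U : Set V) : localAlgebra E U ≤ Prod.instMeasurableSpace :=
  iSup₂_le fun v _ => (measurable_vertexData v).comap_le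

theorem localAlgebra_mono {U U' : Set V} (h : U ⊆ U') : localAlgebra E U ≤ localAlgebra E U' :=
  biSup_mono h

theorem measurable_vertexData_localAlgebra {U : Set V} {v : V} (hv : v ∈ U) :
    Measurable[localAlgebra E U] (vertexData v) :=
  Measurable.mono (comap_measurable _) (le_biSup (fun v => MeasurableSpace.comap (vertexData v) _)
    hv) le_rfl

theorem measurable_initial_localAlgebra {U : Set V} {v : V} (hv : v ∈ U) :
    Measurable[localAlgebra E U] fun ω : Sample V E => ω.1 v :=
  measurable_fst.comp (measurable_vertexData_localAlgebra hv)

theorem measurable_poll_localAlgebra {U : Set V} {v : V} (hv : v ∈ U) (τ : ℕ) :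
    Measurable[localAlgebra E U] fun ω : Sample V E => ω.2 (τ, v) :=
  ((measurable_pi_apply τ).comp measurable_snd).comp (measurable_vertexData_localAlgebra hv)

open Classical in
theorem measurable_majority {Ω ι : Type*} [Finite ι] {_ : MeasurableSpace Ω} {Q : Ω → Finset ι}
    {c : Ω → ι → Bool} (hQ : Measurable Q) (hc : ∀ i, Measurable fun ω => c ω i) :
    Measurable fun ω => decide ((Q ω).card < 2 * ((Q ω).filter fun i => c ω i = true).card) :=
  (Measurable.of_discrete (f := fun x : Finset ι × (ι → Bool) =>
    decide (x.1.card < 2 * (x.1.filter fun i => x.2 i = true).card))).comp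
      (hQ.prodMk (measurable_pi_lambda _ hc))

theorem measurable_guardedColour [Finite E] (G : Multigraph V E) (s : ℕ) (h : E × Bool) :
    Measurable[localAlgebra E (G.reach s h)] fun ω => guardedColour G ω s h := by
  classical
  induction s generalizing h with
  | zero => exact measurable_initial_localAlgebra (tip_mem_reach 0 h)
  | succ s ih =>
    have next (h' : E × Bool) : Measurable[localAlgebra E (G.reach (s + 1) h)] fun ω =>
        decide (G.Follows h h' → guardedColour G ω s h' = true) := by
      by_cases hf : G.Follows h h'
      · simpa [hf] using (ih h').mono (localAlgebra_mono hf.reach_subset) le_rfl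
      · simp [hf]
    simpa only [guardedColour, decide_eq_true_eq] using
      measurable_majority (measurable_poll_localAlgebra (tip_mem_reach _ h) (s + 1)) next

theorem majority_guardedColour_le {G : Multigraph V E} {ω : Sample V E} {s i : ℕ} {h₀ : E × Bool}
    {Q Q' : Finset (E × Bool)} (hQ : Q.card = 2 * i + 1) (hQ' : Q' ⊆ Q) (hcard : Q'.card = 2 * i)
    (hfol : ∀ h' ∈ Q', G.Follows h₀ h') (hpoll : ω.2 (s + 1, G.tip h₀) = Q)
    (hred : guardedColour G ω (s + 1) h₀ = true) :
    i ≤ (Q'.filter fun h' => guardedColour G ω s h' = true).card := by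
  classical
  simp only [guardedColour, hpoll, hQ, decide_eq_true_eq] at hred
  have red_subset : (Q.filter fun h' => G.Follows h₀ h' → guardedColour G ω s h' = true) ⊆
      (Q'.filter fun h' => guardedColour G ω s h' = true) ∪ Q \ Q' := by
    intro h' hh'
    simp only [Finset.mem_filter, Finset.mem_union, Finset.mem_sdiff] at hh' ⊢
    by_cases hmem : h' ∈ Q'
    · exact Or.inl ⟨hmem, hh'.2 (hfol h' hmem)⟩
    · exact Or.inr ⟨hh'.1, hmem⟩
  have red_le := (Finset.card_le_card red_subset).trans (Finset.card_union_le _ _)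
  rw [Finset.card_sdiff_of_subset hQ'] at red_le
  omega

variable [Fintype E] [DecidableEq V]

theorem pollLaw_eq_zero (G : Multigraph V E) (k : ℕ) (v : V) {Q : Finset (E × Bool)}
    (hQ : Q ∉ (G.halfEdgesAt v).powersetCard (pollSize G k v)) : pollLaw G k v Q = 0 :=
  PMF.uniformOfFinset_apply_of_notMem _ hQ

variable [Fintype V]

theorem measurePreserving_vertexData (G : Multigraph V E) (k : ℕ) (α : unitInterval) :
    MeasurePreserving (fun ω v => vertexData v ω) (protocolLaw G k α)
      (Measure.pi fun v => (bernoulliMeasure true false α).prod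
        (Measure.infinitePi fun _ : ℕ => (pollLaw G k v).toMeasure)) := by
  have swap : MeasurePreserving (fun (N : ℕ × V → Finset (E × Bool)) q => N (Prod.swap q))
      (Measure.infinitePi fun p : ℕ × V => (pollLaw G k p.2).toMeasure)
      (Measure.infinitePi fun q : V × ℕ => (pollLaw G k q.1).toMeasure) :=
    ⟨by fun_prop, Measure.map_infinitePi_infinitePi_of_inj Prod.swap_injective⟩
  have curry : MeasurePreserving (MeasurableEquiv.curry V ℕ (Finset (E × Bool)))
      (Measure.infinitePi fun q : V × ℕ => (pollLaw G k q.1).toMeasure)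
      (Measure.pi fun v => Measure.infinitePi fun _ : ℕ => (pollLaw G k v).toMeasure) :=
    ⟨MeasurableEquiv.measurable _, by
      rw [← Measure.infinitePi_eq_pi]
      exact Measure.infinitePi_map_curry fun v (_ : ℕ) => (pollLaw G k v).toMeasure⟩
  exact (measurePreserving_arrowProdEquivProdArrow _ _ _ _ _).symm.comp
    ((MeasurePreserving.id _).prod (curry.comp swap))

theorem iIndep_vertexData (G : Multigraph V E) (k : ℕ) (α : unitInterval) :
    iIndep (fun v => MeasurableSpace.comap (vertexData v : Sample V E → _) inferInstance)
      (protocolLaw G k α) := by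
  refine iIndepFun.iIndep ?_
  rw [iIndepFun_iff_map_fun_eq_pi_map fun v => (measurable_vertexData v).aemeasurable,
    (measurePreserving_vertexData G k α).map_eq]
  congr 1 with v : 1
  exact ((measurePreserving_eval _ v).comp (measurePreserving_vertexData G k α)).map_eq.symm

theorem measurePreserving_initial (G : Multigraph V E) (k : ℕ) (α : unitInterval) (v : V) :
    MeasurePreserving (fun ω => ω.1 v) (protocolLaw G k α) (bernoulliMeasure true false α) :=
  (measurePreserving_eval (fun _ : V => bernoulliMeasure true false α) v).comp
    measurePreserving_fst

theorem measurePreserving_poll (G : Multigraph V E) (k : ℕ) (α : unitInterval) (p : ℕ × V) :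
    MeasurePreserving (fun ω => ω.2 p) (protocolLaw G k α) (pollLaw G k p.2).toMeasure :=
  (measurePreserving_eval_infinitePi (fun p : ℕ × V => (pollLaw G k p.2).toMeasure) p).comp
    measurePreserving_snd

theorem measureReal_initial_red (G : Multigraph V E) (k : ℕ) (α : unitInterval) (v : V) :
    (protocolLaw G k α).real {ω | ω.1 v = true} = α := by
  have := (measurePreserving_initial G k α v).measureReal_preimage
    (MeasurableSet.singleton true).nullMeasurableSet
  exact this.trans (bernoulliMeasure_real_apply_of_mem_of_notMem α (.singleton true) rfl
    (by simp))

theorem measureReal_poll_eq (G : Multigraph V E) (k : ℕ) (α : unitInterval) (p : ℕ × V)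
    (Q : Finset (E × Bool)) :
    (protocolLaw G k α).real {ω | ω.2 p = Q} = (pollLaw G k p.2 Q).toReal := by
  have := (measurePreserving_poll G k α p).measureReal_preimage
    (MeasurableSet.singleton Q).nullMeasurableSet
  rwa [measureReal_def (pollLaw G k p.2).toMeasure,
    PMF.toMeasure_apply_singleton _ _ (MeasurableSet.singleton Q)] at this

theorem sum_measureReal_poll (G : Multigraph V E) (k : ℕ) (α : unitInterval) (p : ℕ × V) :
    ∑ Q : Finset (E × Bool), (protocolLaw G k α).real {ω | ω.2 p = Q} = 1 := by
  simp only [measureReal_poll_eq]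
  rw [← ENNReal.toReal_sum fun Q _ => PMF.apply_ne_top _ _, ← tsum_fintype (L := .unconditional _),
    PMF.tsum_coe, ENNReal.toReal_one]

theorem measureReal_poll_inter_guardedColour_le (G : Multigraph V E) (k : ℕ) (α : unitInterval)
    {s i : ℕ} {h₀ : E × Bool} (ht : G.TreeLike (s + 2) h₀) {Q : Finset (E × Bool)}
    (hQ : Q ⊆ G.halfEdgesAt (G.tip h₀)) (hcard : Q.card = 2 * i + 1) {p : ℝ}
    (hp : ∀ h', G.Follows h₀ h' →
      (protocolLaw G k α).real {ω | guardedColour G ω s h' = true} ≤ p) (h1 : p ≤ 1) :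
    (protocolLaw G k α).real
        ({ω | ω.2 (s + 1, G.tip h₀) = Q} ∩ {ω | guardedColour G ω (s + 1) h₀ = true}) ≤
      (protocolLaw G k α).real {ω | ω.2 (s + 1, G.tip h₀) = Q} * majorityMap i p := by
  classical
  obtain ⟨Q', hQ', hcard'⟩ : ∃ Q' ⊆ Q.erase (rev h₀), Q'.card = 2 * i :=
    Finset.exists_subset_card_eq (by have := Q.pred_card_le_card_erase (a := rev h₀); omega)
  have hfol (h' : E × Bool) (hh' : h' ∈ Q') : G.Follows h₀ h' :=
    have ⟨hne, hmem⟩ := Finset.mem_erase.1 (hQ' hh')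
    ⟨(Finset.mem_filter.1 (hQ hmem)).2, hne⟩
  set w := G.tip h₀
  set B : Set (Sample V E) := {ω | ω.2 (s + 1, w) = Q}
  set R : E × Bool → Set (Sample V E) := fun h' => {ω | guardedColour G ω s h' = true}
  set C : Set (Sample V E) := {ω | i ≤ (Q'.filter fun h' => ω ∈ R h').card}
  have hB : MeasurableSet[localAlgebra E {w}] B :=
    measurable_poll_localAlgebra (Set.mem_singleton w) (s + 1) (.singleton Q)
  have hR (h' : E × Bool) : MeasurableSet[localAlgebra E (G.reach s h')] (R h') :=
    measurable_guardedColour G s h' (.singleton true)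
  have hC : MeasurableSet[localAlgebra E (⋃ h' ∈ Q', G.reach s h')] C := by
    refine measurableSet_le_card_filter (mΩ := localAlgebra E _) (fun h' hh' => ?_) i
    exact localAlgebra_mono (Set.subset_biUnion_of_mem (u := G.reach s) hh') _ (hR h')
  have indep : Indep (localAlgebra E {w}) (localAlgebra E (⋃ h' ∈ Q', G.reach s h'))
      (protocolLaw G k α) :=
    indep_iSup_of_disjoint (fun v => (measurable_vertexData v).comap_le) (iIndep_vertexData G k α)
      (Set.disjoint_iUnion₂_right.2 fun h' hh' =>
        Set.disjoint_singleton_left.2 (ht.tip_notMem_reach (hfol h' hh')))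
  calc (protocolLaw G k α).real (B ∩ {ω | guardedColour G ω (s + 1) h₀ = true})
      ≤ (protocolLaw G k α).real (B ∩ C) :=
        measureReal_mono fun ω hω => ⟨hω.1, majority_guardedColour_le hcard
          (hQ'.trans (Finset.erase_subset _ _)) hcard' hfol hω.1 hω.2⟩
    _ = (protocolLaw G k α).real B * (protocolLaw G k α).real C := by
        simp only [measureReal_def, (Indep_iff _ _ _).1 indep B C hB hC, ENNReal.toReal_mul]
    _ ≤ (protocolLaw G k α).real B * majorityMap i p := by
        gcongr
        rw [majorityMap, ← hcard']
        exact measureReal_le_card_filter_le_binTail (fun v => (measurable_vertexData v).comap_le)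
          (iIndep_vertexData G k α) (fun h' _ => hR h') (fun h₁ hh₁ h₂ hh₂ hne =>
            ht.disjoint_reach (hfol h₁ hh₁) (hfol h₂ hh₂) hne) (fun h' hh' => hp h' (hfol h' hh'))
          h1 i

theorem measureReal_guardedColour_le {G : Multigraph V E} {k h : ℕ} {α : unitInterval}
    (hh : 2 ≤ h) (hα : (α : ℝ) < alphaStar (2 * h + 1))
    (hpoll : ∀ v, ∃ i, h ≤ i ∧ pollSize G k v = 2 * i + 1) (s : ℕ) {h₀ : E × Bool}
    (ht : G.TreeLike (s + 1) h₀) :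
    (protocolLaw G k α).real {ω | guardedColour G ω s h₀ = true} ≤ redSeq h α s := by
  induction s generalizing h₀ with
  | zero => exact (measureReal_initial_red G k α (G.tip h₀)).le
  | succ s ih =>
    set p := redSeq h α s
    have hp0 : 0 ≤ p := (redSeq_mem_Icc hh α.2.1 hα s).1
    have hp1 : p ≤ 1 / 2 := redSeq_le_half hh α.2.1 hα s
    set X : Set (Sample V E) := {ω | guardedColour G ω (s + 1) h₀ = true}
    set B : Finset (E × Bool) → Set (Sample V E) := fun Q => {ω | ω.2 (s + 1, G.tip h₀) = Q}
    have given_poll (Q : Finset (E × Bool)) : (protocolLaw G k α).real (B Q ∩ X) ≤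
        (protocolLaw G k α).real (B Q) * majorityMap h p := by
      by_cases hQ : Q ∈ (G.halfEdgesAt (G.tip h₀)).powersetCard (pollSize G k (G.tip h₀))
      · obtain ⟨i, hi, hsize⟩ := hpoll (G.tip h₀)
        rw [hsize, Finset.mem_powersetCard] at hQ
        refine (measureReal_poll_inter_guardedColour_le G k α ht hQ.1 hQ.2
          (fun h' hf => ih (ht.of_follows hf)) (by linarith)).trans ?_
        gcongr
        exact majorityMap_antitone hp0 hp1 hi
      · have null : (protocolLaw G k α).real (B Q) = 0 := by
          rw [measureReal_poll_eq, pollLaw_eq_zero G k _ hQ, ENNReal.toReal_zero]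
        rw [null, zero_mul]
        exact (measureReal_mono Set.inter_subset_left).trans null.le
    calc (protocolLaw G k α).real X
        ≤ (protocolLaw G k α).real (⋃ Q ∈ Finset.univ, B Q ∩ X) :=
          measureReal_mono (fun ω hω => by simpa [B] using hω) (measure_ne_top _ _)
      _ ≤ ∑ Q, (protocolLaw G k α).real (B Q ∩ X) := measureReal_biUnion_finset_le _ _
      _ ≤ ∑ Q, (protocolLaw G k α).real (B Q) * majorityMap h p :=
          Finset.sum_le_sum fun Q _ => given_poll Q
      _ = majorityMap h p := by rw [← Finset.sum_mul, sum_measureReal_poll, one_mul]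

end Guarded

/-! ### The probability that given edges are present -/

section RisingFactorial

theorem ascPochhammer_eval_succ_left {S : Type*} [CommSemiring S] (x : S) (r : ℕ) :
    (ascPochhammer S (r + 1)).eval x = x * (ascPochhammer S r).eval (x + 1) := by
  simp [ascPochhammer_succ_left]

theorem mul_ascPochhammer_eval_add_one {S : Type*} [CommSemiring S] (x : S) (r : ℕ) :
    x * (ascPochhammer S r).eval (x + 1) = (x + r) * (ascPochhammer S r).eval x := by
  rw [← ascPochhammer_eval_succ_left, ascPochhammer_succ_eval, mul_comm]

theorem ascPochhammer_eval_mono {x y : ℝ≥0} (h : x ≤ y) (r : ℕ) :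
    (ascPochhammer ℝ≥0 r).eval x ≤ (ascPochhammer ℝ≥0 r).eval y := by
  induction r with
  | zero => simp
  | succ r ih =>
    rw [ascPochhammer_succ_eval, ascPochhammer_succ_eval]
    gcongr

theorem ascPochhammer_eval_le_pow {x c : ℝ≥0} {r : ℕ} (h : ∀ l < r, x + l ≤ c) :
    (ascPochhammer ℝ≥0 r).eval x ≤ c ^ r := by
  induction r with
  | zero => simp
  | succ r ih =>
    rw [ascPochhammer_succ_eval, pow_succ]
    exact mul_le_mul' (ih fun l hl => h l (by lia)) (h r r.lt_succ_self)

end RisingFactorial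

section Attachment

variable {n : ℕ} (δ : ℝ≥0) (F : Finset ℕ) (g : ℕ → ℕ)

/-- The in-degree of the vertex of index `x`: the number of edges that were sent to it. -/
def indeg (e : PATree n) (x : ℕ) : ℕ := (Finset.univ.filter fun j : Fin n => (e j : ℕ) = x).card

theorem degree_graph (e : PATree n) (i : Fin n) : e.graph.degree i = 1 + indeg e i := by
  unfold Multigraph.degree Multigraph.halfEdgesAt indeg
  rw [Finset.card_filter, Finset.card_filter, Fintype.sum_prod_type]
  simp only [Multigraph.base, PATree.graph, Fintype.sum_bool, if_true, Bool.false_eq_true,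
    if_false, Finset.sum_add_distrib, Fin.ext_iff, Fin.val_castLE]
  rw [add_comm]
  congr 1
  simp [← Fin.ext_iff]

theorem indeg_eq_zero (e : PATree n) {x : ℕ} (hx : n ≤ x) : indeg e x = 0 := by
  rw [indeg, Finset.card_eq_zero, Finset.filter_eq_empty_iff]
  exact fun j _ => ((Nat.lt_succ_iff.1 (e j).isLt).trans_lt (j.isLt.trans_le hx)).ne

theorem indeg_extend (e : PATree n) (i : Fin (n + 1)) (x : ℕ) :
    indeg (e.extend i) x = indeg e x + if (i : ℕ) = x then 1 else 0 := by
  unfold indeg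
  rw [Finset.card_filter, Finset.card_filter, Fin.sum_univ_castSucc]
  simp [PATree.extend]

/-- The attachment weight `D_x + δ` of the vertex `x`. A vertex that is not yet present gets the
largest weight that it can have when it appears, so that appearing does not raise the weight. -/
def vertexWeight (e : PATree n) (x : ℕ) : ℝ≥0 :=
  if x < n then 1 + indeg e x + δ else 2 + δ

theorem vertexWeight_extend_le_of_imp_ne (e : PATree n) {i : Fin (n + 1)} {x : ℕ}
    (hi : x < n → (i : ℕ) ≠ x) : vertexWeight δ (e.extend i) x ≤ vertexWeight δ e x := by
  unfold vertexWeight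
  rw [indeg_extend]
  rcases lt_trichotomy x n with h | rfl | h
  · rw [if_pos (h.trans n.lt_succ_self), if_pos h, if_neg (hi h), add_zero]
  · rw [if_pos x.lt_succ_self, if_neg (lt_irrefl x), indeg_eq_zero e le_rfl, zero_add,
      ← one_add_one_eq_two]
    gcongr
    split_ifs <;> simp
  · rw [if_neg (by lia), if_neg h.not_gt]

theorem vertexWeight_extend_le_add_one (e : PATree n) (i : Fin (n + 1)) (x : ℕ) :
    vertexWeight δ (e.extend i) x ≤ vertexWeight δ e x + 1 := by
  by_cases hi : x < n → (i : ℕ) ≠ x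
  · exact (vertexWeight_extend_le_of_imp_ne δ e hi).trans le_self_add
  · push Not at hi
    rw [vertexWeight, vertexWeight, if_pos (hi.1.trans n.lt_succ_self), if_pos hi.1, indeg_extend,
      if_pos hi.2]
    push_cast
    exact le_of_eq (by ring)

/-- The normalization of the attachment probabilities in the step from `n` to `n + 1` vertices. -/
def attachTotal (n : ℕ) : ℝ≥0 := n * (2 + δ) + (1 + δ)

variable {δ} in
theorem attachTotal_pos : 0 < attachTotal δ n := by
  unfold attachTotal
  positivity

theorem attachWeight_of_lt (e : PATree n) {i : Fin (n + 1)} (h : (i : ℕ) < n) :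
    attachWeight δ e i = (vertexWeight δ e i / attachTotal δ n : ℝ≥0) := by
  rw [attachWeight, dif_pos h, vertexWeight, if_pos h, degree_graph,
    ENNReal.coe_div attachTotal_pos.ne']
  push_cast
  rfl

theorem attachWeight_le (e : PATree n) (i : Fin (n + 1)) :
    attachWeight δ e i ≤ (vertexWeight δ e i / attachTotal δ n : ℝ≥0) := by
  by_cases h : (i : ℕ) < n
  · exact (attachWeight_of_lt δ e h).le
  · rw [attachWeight, dif_neg h, vertexWeight, if_neg h, ENNReal.coe_div attachTotal_pos.ne']
    push_cast
    exact ENNReal.div_le_div_right (by gcongr; exact one_le_two) _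

/-- The number of the edges in `F` with index at least `n` that `g` prescribes to be sent to the
vertex `i`. -/
def demand (n i : ℕ) : ℕ := (F.filter fun j => n ≤ j ∧ g j = i).card

/-- The weight that compensates for the growth of the degrees: an edge of `F` sent to `i` takes the
leading factor `x` from the rising factorial `x (x + 1) ⋯ (x + r - 1)` of the weight of `i`, and
leaves the rising factorial with the new weight `x + 1` and the new demand `r - 1`. -/
def potential (e : PATree n) : ℝ≥0 :=
  ∏ i ∈ F.image g, (ascPochhammer ℝ≥0 (demand F g n i)).eval (vertexWeight δ e i)

/-- The edges of `e` with index in `F` are sent to the vertices prescribed by `g`. -/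
def AttachedAs (e : PATree n) : Prop := ∀ j : Fin n, (j : ℕ) ∈ F → (e j : ℕ) = g j

/-- A bound for the factor that the step from `n` to `n + 1` vertices contributes to the probability
that the edges in `F` are sent to the vertices prescribed by `g`. -/
def stepFactor (n : ℕ) : ℝ≥0 :=
  if n ∈ F then (attachTotal δ n)⁻¹
  else 1 + (F.filter fun j => g j < n ∧ n < j).card / attachTotal δ n

theorem attachedAs_extend (e : PATree n) (i : Fin (n + 1)) :
    AttachedAs F g (e.extend i) ↔ AttachedAs F g e ∧ (n ∈ F → (i : ℕ) = g n) := by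
  unfold AttachedAs
  rw [Fin.forall_fin_succ']
  simp [PATree.extend]

variable {F g}

theorem demand_of_notMem (hn : n ∉ F) (i : ℕ) : demand F g n i = demand F g (n + 1) i := by
  unfold demand
  congr 1
  refine Finset.filter_congr fun j hj => ?_
  have : j ≠ n := ne_of_mem_of_not_mem hj hn
  lia

theorem demand_of_ne {i : ℕ} (hi : g n ≠ i) : demand F g n i = demand F g (n + 1) i := by
  unfold demand
  congr 1
  refine Finset.filter_congr fun j _ => and_congr_left fun hj => ?_
  have : j ≠ n := by
    rintro rfl
    exact hi hj
  lia

theorem demand_apply_of_mem (hn : n ∈ F) : demand F g n (g n) = demand F g (n + 1) (g n) + 1 := by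
  unfold demand
  rw [← Finset.card_insert_of_notMem (a := n) (by simp)]
  congr 1
  ext j
  simp only [Finset.mem_filter, Finset.mem_insert]
  grind

theorem demand_eq_zero (hF : F ⊆ Finset.range n) (i : ℕ) : demand F g n i = 0 := by
  rw [demand, Finset.card_eq_zero, Finset.filter_eq_empty_iff]
  exact fun j hj h => (Finset.mem_range.1 (hF hj)).not_ge h.1

theorem sum_demand_eq_card (hn : n ∉ F) :
    ∑ i : Fin n, demand F g n i = (F.filter fun j => g j < n ∧ n < j).card := by
  rw [Fin.sum_univ_eq_sum_range fun i => demand F g n i,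
    Finset.card_eq_sum_card_fiberwise (f := g) (t := Finset.range n)]
  · refine Finset.sum_congr rfl fun i hi => ?_
    rw [demand, Finset.filter_filter]
    congr 1
    refine Finset.filter_congr fun j hj => ?_
    have : j ≠ n := ne_of_mem_of_not_mem hj hn
    have := Finset.mem_range.1 hi
    lia
  · intro j hj
    simpa using (Finset.mem_filter.1 (Finset.mem_coe.1 hj)).2.1

theorem potential_eq_one (hF : F ⊆ Finset.range n) (e : PATree n) : potential δ F g e = 1 :=
  Finset.prod_eq_one fun i _ => by rw [demand_eq_zero hF, ascPochhammer_zero, Polynomial.eval_one]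

theorem potential_extend_le (hn : n ∉ F) (e : PATree n) {i : Fin (n + 1)}
    (hi : ∀ y ∈ F.image g, y < n → (i : ℕ) ≠ y) :
    potential δ F g (e.extend i) ≤ potential δ F g e := by
  refine Finset.prod_le_prod' fun y hy => ?_
  rw [demand_of_notMem hn]
  exact ascPochhammer_eval_mono (vertexWeight_extend_le_of_imp_ne δ e (hi y hy)) _

theorem vertexWeight_mul_potential_extend_le_of_notMem (hn : n ∉ F) (e : PATree n)
    (i : Fin (n + 1)) :
    vertexWeight δ e i * potential δ F g (e.extend i)
      ≤ (vertexWeight δ e i + demand F g n i) * potential δ F g e := by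
  by_cases hi : (i : ℕ) ∈ F.image g
  · unfold potential
    rw [← Finset.mul_prod_erase _ _ hi, ← Finset.mul_prod_erase _ _ hi, ← mul_assoc, ← mul_assoc,
      ← mul_ascPochhammer_eval_add_one]
    gcongr 1
    · rw [demand_of_notMem hn]
      gcongr 1
      exact ascPochhammer_eval_mono (vertexWeight_extend_le_add_one δ e i i) _
    · refine Finset.prod_le_prod' fun y hy => ?_
      rw [demand_of_notMem hn]
      exact ascPochhammer_eval_mono (vertexWeight_extend_le_of_imp_ne δ e
        fun _ => (Finset.ne_of_mem_erase hy).symm) _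
  · exact mul_le_mul' le_self_add
      (potential_extend_le δ hn e fun y hy _ => (ne_of_mem_of_not_mem hy hi).symm)

theorem vertexWeight_mul_potential_extend_le_of_mem (hn : n ∈ F) (e : PATree n) {i : Fin (n + 1)}
    (hi : (i : ℕ) = g n) :
    vertexWeight δ e i * potential δ F g (e.extend i) ≤ potential δ F g e := by
  have hgn : (i : ℕ) ∈ F.image g := hi ▸ Finset.mem_image_of_mem g hn
  unfold potential
  rw [← Finset.mul_prod_erase _ _ hgn, ← Finset.mul_prod_erase _ _ hgn, ← mul_assoc]
  gcongr 1
  · rw [hi, demand_apply_of_mem hn, ascPochhammer_eval_succ_left]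
    gcongr 1
    exact ascPochhammer_eval_mono (vertexWeight_extend_le_add_one δ e i _) _
  · refine Finset.prod_le_prod' fun y hy => ?_
    have hiy : (i : ℕ) ≠ y := (Finset.ne_of_mem_erase hy).symm
    rw [demand_of_ne (hi.symm.trans_ne hiy)]
    exact ascPochhammer_eval_mono (vertexWeight_extend_le_of_imp_ne δ e fun _ => hiy) _

theorem attachWeight_mul_potential_le_of_mem (hn : n ∈ F) (e : PATree n) {i : Fin (n + 1)}
    (hi : (i : ℕ) = g n) :
    attachWeight δ e i * potential δ F g (e.extend i)
      ≤ (((attachTotal δ n)⁻¹ : ℝ≥0) : ℝ≥0∞) * potential δ F g e := by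
  refine (mul_le_mul_left (attachWeight_le δ e i) _).trans ?_
  norm_cast
  rw [div_mul_eq_mul_div, div_eq_inv_mul]
  gcongr
  exact vertexWeight_mul_potential_extend_le_of_mem δ hn e hi

theorem attachWeight_mul_potential_le_of_notMem (hn : n ∉ F) (e : PATree n) (i : Fin (n + 1)) :
    attachWeight δ e i * potential δ F g (e.extend i)
      ≤ (attachWeight δ e i +
          ((if (i : ℕ) < n then demand F g n i / attachTotal δ n else 0 : ℝ≥0) : ℝ≥0∞)) *
        potential δ F g e := by
  by_cases hi : (i : ℕ) < n
  · rw [if_pos hi, attachWeight_of_lt δ e hi]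
    norm_cast
    rw [← add_div, div_mul_eq_mul_div, div_mul_eq_mul_div]
    exact div_le_div_of_nonneg_right (vertexWeight_mul_potential_extend_le_of_notMem δ hn e i)
      zero_le
  · rw [if_neg hi, ENNReal.coe_zero, add_zero]
    gcongr
    exact potential_extend_le δ hn e fun y _ hy h => hi (h ▸ hy)

theorem sum_attachWeight_mul_potential_le (hn : n ∉ F) (e : PATree n) :
    ∑ i, attachWeight δ e i * potential δ F g (e.extend i)
      ≤ ((1 + (F.filter fun j => g j < n ∧ n < j).card / attachTotal δ n : ℝ≥0) : ℝ≥0∞) *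
        potential δ F g e := by
  refine (Finset.sum_le_sum fun i _ =>
    attachWeight_mul_potential_le_of_notMem δ hn e i).trans (le_of_eq ?_)
  rw [← Finset.sum_mul, Finset.sum_add_distrib, sum_attachWeight, ← sum_demand_eq_card hn,
    Fin.sum_univ_castSucc fun i : Fin (n + 1) =>
      ((if (i : ℕ) < n then demand F g n i / attachTotal δ n else 0 : ℝ≥0) : ℝ≥0∞)]
  simp only [Fin.val_castSucc, Fin.is_lt, if_true, Fin.val_last, lt_irrefl, if_false]
  push_cast
  rw [add_zero, ← ENNReal.ofNNReal_finsetSum, ← Finset.sum_div]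

variable (F g)

theorem sum_attachWeight_mul_indicator_le (e : PATree n) :
    ∑ i, attachWeight δ e i *
        {e | AttachedAs F g e}.indicator (fun e => (potential δ F g e : ℝ≥0∞)) (e.extend i)
      ≤ stepFactor δ F g n *
        {e | AttachedAs F g e}.indicator (fun e => (potential δ F g e : ℝ≥0∞)) e := by
  classical
  simp only [Set.indicator_apply, Set.mem_ofPred_eq, attachedAs_extend]
  by_cases he : AttachedAs F g e
  swap
  · simp [he]
  simp only [he, true_and, if_true, mul_ite, mul_zero]
  by_cases hn : n ∈ F
  · simp only [stepFactor, hn, true_imp_iff, if_true]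
    by_cases hg : g n < n + 1
    · have hi (i : Fin (n + 1)) : (i : ℕ) = g n ↔ i = ⟨g n, hg⟩ := by
        rw [Fin.ext_iff]
      simp only [hi, Finset.sum_ite_eq', Finset.mem_univ, if_true]
      exact attachWeight_mul_potential_le_of_mem δ hn e rfl
    · have hi (i : Fin (n + 1)) : (i : ℕ) ≠ g n := (i.isLt.trans_le (not_lt.1 hg)).ne
      simp [hi]
  · simp only [stepFactor, hn, false_imp_iff, if_true, if_false]
    exact sum_attachWeight_mul_potential_le δ hn e

theorem tsum_bind_mul {α β : Type*} (p : PMF α) (q : α → PMF β) (f : β → ℝ≥0∞) :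
    ∑' b, p.bind q b * f b = ∑' a, p a * ∑' b, q a b * f b := by
  simp_rw [PMF.bind_apply, ← ENNReal.tsum_mul_right, ← ENNReal.tsum_mul_left, mul_assoc]
  exact ENNReal.tsum_comm

theorem tsum_map_mul {α β : Type*} (p : PMF α) (u : α → β) (f : β → ℝ≥0∞) :
    ∑' b, p.map u b * f b = ∑' a, p a * f (u a) := by
  rw [PMF.map, tsum_bind_mul]
  refine tsum_congr fun a => ?_
  rw [tsum_eq_single (u a)]
  · simp
  · intro b hb
    simp [hb]

theorem tsum_paTreeLaw_succ (n : ℕ) (f : PATree (n + 1) → ℝ≥0∞) :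
    ∑' e, paTreeLaw δ (n + 1) e * f e
      = ∑' e, paTreeLaw δ n e * ∑ i, attachWeight δ e i * f (e.extend i) := by
  rw [paTreeLaw, tsum_bind_mul]
  refine tsum_congr fun e => ?_
  rw [tsum_map_mul, tsum_fintype]
  rfl

theorem tsum_paTreeLaw_mul_potential_le (n : ℕ) :
    ∑' e : PATree n, paTreeLaw δ n e *
        {e | AttachedAs F g e}.indicator (fun e => (potential δ F g e : ℝ≥0∞)) e
      ≤ ((∏ i ∈ F.image g, (ascPochhammer ℝ≥0 (demand F g 0 i)).eval (2 + δ)) *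
          ∏ l ∈ Finset.range n, stepFactor δ F g l : ℝ≥0) := by
  induction n with
  | zero =>
    simp only [AttachedAs, potential, vertexWeight, IsEmpty.forall_iff, Set.ofPred_true,
      Set.indicator_univ, not_lt_zero, if_false, Finset.range_zero, Finset.prod_empty, mul_one]
    rw [ENNReal.tsum_mul_right, PMF.tsum_coe, one_mul]
  | succ n ih =>
    rw [tsum_paTreeLaw_succ]
    calc _ ≤ ∑' e : PATree n, paTreeLaw δ n e * (stepFactor δ F g n *
          {e | AttachedAs F g e}.indicator (fun e => (potential δ F g e : ℝ≥0∞)) e) :=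
          ENNReal.tsum_le_tsum fun e =>
            mul_le_mul_right (sum_attachWeight_mul_indicator_le δ F g e) _
      _ = stepFactor δ F g n * ∑' e : PATree n, paTreeLaw δ n e *
          {e | AttachedAs F g e}.indicator (fun e => (potential δ F g e : ℝ≥0∞)) e := by
          simp only [mul_left_comm _ (stepFactor δ F g n : ℝ≥0∞), ENNReal.tsum_mul_left]
      _ ≤ _ := by
          refine (mul_le_mul_right ih _).trans (le_of_eq ?_)
          rw [Finset.prod_range_succ]
          push_cast
          ring

theorem paTreeLaw_attachedAs_le {F : Finset ℕ} {N : ℕ} (hF : F ⊆ Finset.range N) :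
    (paTreeLaw δ N).toMeasure {e | AttachedAs F g e}
      ≤ ((∏ i ∈ F.image g, (ascPochhammer ℝ≥0 (demand F g 0 i)).eval (2 + δ)) *
          ∏ l ∈ Finset.range N, stepFactor δ F g l : ℝ≥0) := by
  classical
  refine le_trans (le_of_eq ?_) (tsum_paTreeLaw_mul_potential_le δ F g N)
  rw [PMF.toMeasure_apply _ (Set.toFinite _).measurableSet]
  simp [potential_eq_one δ hF, Set.indicator_apply]

end Attachment

section Estimates

theorem one_add_inv_two_mul_add_one_le_sqrt {x : ℝ} (hx : 0 < x) :
    1 + 1 / (2 * x + 1) ≤ √((x + 1) / x) := by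
  refine Real.le_sqrt_of_sq_le ?_
  rw [le_div_iff₀ hx]
  field_simp
  nlinarith

theorem prod_Ico_le_sqrt {a j : ℕ} (h : a + 1 ≤ j) :
    ∏ l ∈ Finset.Ico (a + 1) j, (1 + 1 / (2 * (l : ℝ) + 1)) ≤ √(j / (a + 1)) := by
  induction j, h using Nat.le_induction with
  | base =>
    push_cast
    rw [div_self (by positivity)]
    simp
  | succ j hj ih =>
    have hj0 : (0 : ℝ) < j := Nat.cast_pos.2 (by lia)
    rw [Finset.prod_Ico_succ_top hj]
    calc _ ≤ √(j / (a + 1)) * √((j + 1) / j) := by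
          gcongr
          exact one_add_inv_two_mul_add_one_le_sqrt hj0
      _ = √((j + 1 : ℕ) / (a + 1)) := by
          rw [← Real.sqrt_mul (by positivity)]
          congr 1
          push_cast
          field_simp

theorem prod_Ioo_le_sqrt {a j : ℕ} (h : a ≤ j) :
    ∏ l ∈ Finset.Ioo a j, (1 + 1 / (2 * (l : ℝ) + 1)) ≤ √((j + 1) / (a + 1)) := by
  rcases h.eq_or_lt with rfl | h
  · rw [div_self (by positivity)]
    simp
  · refine (prod_Ico_le_sqrt (Nat.succ_le_of_lt h)).trans ?_
    gcongr
    linarith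

variable (δ : ℝ≥0) (F : Finset ℕ) (g : ℕ → ℕ)

theorem prod_ascPochhammer_demand_le :
    ∏ i ∈ F.image g, (ascPochhammer ℝ≥0 (demand F g 0 i)).eval (2 + δ)
      ≤ ((F.card + 1) * (1 + δ)) ^ F.card := by
  have hcard : ∑ i ∈ F.image g, demand F g 0 i = F.card := by
    rw [Finset.card_eq_sum_card_image g F]
    simp [demand]
  rw [← hcard, ← Finset.prod_pow_eq_pow_sum, hcard]
  refine Finset.prod_le_prod' fun i _ => ascPochhammer_eval_le_pow fun l hl => ?_
  have hl' : (l : ℝ≥0) + 1 ≤ F.card := by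
    exact_mod_cast (Nat.succ_le_of_lt hl).trans (Finset.card_filter_le _ _)
  calc 2 + δ + (l : ℝ≥0) = (l + 1) + 1 + δ := by ring
    _ ≤ F.card + 1 + δ := by gcongr
    _ ≤ F.card + 1 + δ + F.card * δ := le_self_add
    _ = _ := by ring

theorem stepFactor_le (l : ℕ) :
    (stepFactor δ F g l : ℝ) ≤ (if l ∈ F then ((1 + (δ : ℝ)) * (l + 1))⁻¹ else 1) *
      ∏ j ∈ F, if l ∈ Finset.Ioo (g j) j then (1 + 1 / (2 * (l : ℝ) + 1)) else 1 := by
  have : (0 : ℝ) ≤ δ := δ.2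
  have : (0 : ℝ) ≤ l := l.cast_nonneg
  have hb : 0 ≤ 1 / (2 * (l : ℝ) + 1) := by positivity
  have htotal : ((attachTotal δ l : ℝ≥0) : ℝ) = l * (2 + δ) + (1 + δ) := by simp [attachTotal]
  rw [← Finset.prod_filter, Finset.prod_const, stepFactor]
  simp only [Finset.mem_Ioo]
  by_cases hl : l ∈ F
  · rw [if_pos hl, if_pos hl, NNReal.coe_inv, htotal]
    calc ((l : ℝ) * (2 + δ) + (1 + δ))⁻¹ ≤ ((1 + (δ : ℝ)) * (l + 1))⁻¹ := by
          gcongr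
          nlinarith
      _ ≤ _ := le_mul_of_one_le_right (by positivity) (one_le_pow₀ (by linarith))
  · rw [if_neg hl, if_neg hl, one_mul]
    push_cast
    rw [htotal, div_eq_mul_one_div]
    have htotal_ge : 1 / ((l : ℝ) * (2 + δ) + (1 + δ)) ≤ 1 / (2 * (l : ℝ) + 1) :=
      one_div_le_one_div_of_le (by positivity) (by nlinarith)
    calc _ ≤ 1 + ((F.filter fun j => g j < l ∧ l < j).card : ℝ) * (1 / (2 * (l : ℝ) + 1)) := by
          gcongr
      _ ≤ _ := one_add_mul_le_pow (by linarith) _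

variable {F g}

theorem prod_stepFactor_le {N : ℕ} (hF : F ⊆ Finset.range N) (hg : ∀ j ∈ F, g j ≤ j) :
    ((∏ l ∈ Finset.range N, stepFactor δ F g l : ℝ≥0) : ℝ)
      ≤ ∏ j ∈ F, (((1 + (δ : ℝ)) * (j + 1))⁻¹ * √((j + 1) / (g j + 1))) := by
  have hfilter : (Finset.range N).filter (· ∈ F) = F :=
    Finset.filter_mem_eq_inter.trans (Finset.inter_eq_right.2 hF)
  have hIoo (j : ℕ) (hj : j ∈ F) :
      (Finset.range N).filter (· ∈ Finset.Ioo (g j) j) = Finset.Ioo (g j) j :=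
    Finset.filter_mem_eq_inter.trans <| Finset.inter_eq_right.2 fun l hl =>
      Finset.mem_range.2 ((Finset.mem_Ioo.1 hl).2.trans (Finset.mem_range.1 (hF hj)))
  rw [NNReal.coe_prod]
  refine (Finset.prod_le_prod (fun _ _ => NNReal.coe_nonneg _)
    fun l _ => stepFactor_le δ F g l).trans ?_
  rw [Finset.prod_mul_distrib, Finset.prod_comm, Finset.prod_mul_distrib, ← Finset.prod_filter,
    hfilter]
  gcongr ?_ * ?_
  refine Finset.prod_le_prod (fun j _ => Finset.prod_nonneg fun l _ => ?_) fun j hj => ?_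
  · split_ifs <;> positivity
  · rw [← Finset.prod_filter, hIoo j hj]
    exact prod_Ioo_le_sqrt (hg j hj)

theorem paTreeLaw_attachedAs_le_prod {N : ℕ} (hF : F ⊆ Finset.range N) (hg : ∀ j ∈ F, g j ≤ j) :
    (paTreeLaw δ N).toMeasure.real {e | AttachedAs F g e}
      ≤ ∏ j ∈ F, ((F.card + 1) * ((√(j + 1))⁻¹ * (√(g j + 1))⁻¹)) := by
  have hrise : ((∏ i ∈ F.image g, (ascPochhammer ℝ≥0 (demand F g 0 i)).eval (2 + δ) : ℝ≥0) : ℝ)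
      ≤ ∏ _j ∈ F, (((F.card : ℝ) + 1) * (1 + δ)) := by
    rw [Finset.prod_const]
    exact_mod_cast prod_ascPochhammer_demand_le δ F g
  rw [measureReal_def]
  refine (ENNReal.toReal_mono ENNReal.coe_ne_top (paTreeLaw_attachedAs_le δ g hF)).trans ?_
  rw [ENNReal.coe_toReal, NNReal.coe_mul]
  refine (mul_le_mul hrise (prod_stepFactor_le δ hF hg) (NNReal.coe_nonneg _)
    (by positivity)).trans (le_of_eq ?_)
  rw [← Finset.prod_mul_distrib]
  refine Finset.prod_congr rfl fun j _ => ?_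
  have hsq : √((j : ℝ) + 1) ^ 2 = j + 1 := Real.sq_sqrt (by positivity)
  have hpos : 0 < √((j : ℝ) + 1) := Real.sqrt_pos.2 (by positivity)
  have : 0 < √((g j : ℝ) + 1) := Real.sqrt_pos.2 (by positivity)
  rw [Real.sqrt_div (by positivity), ← hsq, Real.sqrt_sq hpos.le]
  field_simp

end Estimates

/-! ### Edge sets without leaves -/

namespace Multigraph

variable {V E : Type*} {G : Multigraph V E}

/-- Every vertex other than `v` that is incident with an edge in `F` has degree at least two in
the graph with edge set `F`. -/
def NoLeafExcept (G : Multigraph V E) (F : Finset E) (v : V) : Prop :=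
  ∀ a : E × Bool, a.1 ∈ F → G.base a ≠ v → ∃ b : E × Bool, b.1 ∈ F ∧ G.base b = G.base a ∧ b ≠ a

theorem NoLeafExcept.union [DecidableEq E] {F F' : Finset E} {v : V} (h : G.NoLeafExcept F v)
    (h' : G.NoLeafExcept F' v) : G.NoLeafExcept (F ∪ F') v := by
  intro a ha hv
  rcases Finset.mem_union.1 ha with ha | ha
  · exact (h a ha hv).imp fun _ => And.imp_left (Finset.mem_union_left _)
  · exact (h' a ha hv).imp fun _ => And.imp_left (Finset.mem_union_right _)

theorem eq_or_eq_rev_of_fst_eq {h a : E × Bool} (he : a.1 = h.1) : a = h ∨ a = rev h := by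
  rcases h with ⟨e, b⟩
  rcases a with ⟨e', b'⟩
  obtain rfl : e' = e := he
  cases b <;> cases b' <;> simp [rev]

/-- The edges traversed by a walk. -/
def walkEdges [DecidableEq E] (l : List (E × Bool)) : Finset E := (l.map Prod.fst).toFinset

section walkEdges

variable [DecidableEq E] {h g g' a : E × Bool} {l l' : List (E × Bool)}

@[simp] theorem mem_walkEdges_cons {e : E} :
    e ∈ walkEdges (g :: l) ↔ e = g.1 ∨ e ∈ walkEdges l := by
  simp [walkEdges]

@[simp] theorem walkEdges_nil : walkEdges ([] : List (E × Bool)) = ∅ := rfl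

theorem card_walkEdges_le (l : List (E × Bool)) : (walkEdges l).card ≤ l.length :=
  (List.toFinset_card_le _).trans (by simp)

theorem NBWalk.fst_mem_walkEdges (hw : G.NBWalk h l) : h.1 ∈ walkEdges l := by
  induction hw with
  | single => simp
  | cons _ _ ih => exact mem_walkEdges_cons.2 (Or.inr ih)

theorem NBWalk.exists_ne_base_eq (hw : G.NBWalk h (g :: l)) (ha : a.1 ∈ walkEdges (g :: l))
    (hb : G.base a ≠ G.base h) (hg : a ≠ rev g) :
    ∃ b : E × Bool, b.1 ∈ walkEdges (g :: l) ∧ G.base b = G.base a ∧ b ≠ a := by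
  generalize hL : g :: l = L at hw ha
  induction hw generalizing g l with
  | single =>
    obtain ⟨rfl, rfl⟩ := List.cons.inj hL
    rcases eq_or_eq_rev_of_fst_eq (by simpa using ha) with rfl | rfl
    · exact absurd rfl hb
    · exact absurd rfl hg
  | @cons g₁ g₂ l₁ _ hf ih =>
    obtain ⟨rfl, rfl⟩ := List.cons.inj hL
    by_cases ha' : a.1 ∈ walkEdges (g₁ :: l₁)
    · by_cases hag : a = rev g₁
      · exact ⟨g, by simp, by rw [hag, base_rev, hf.1], hag ▸ hf.2⟩
      · exact (ih hag rfl ha').imp fun _ => And.imp_left (mem_walkEdges_cons.2 ∘ Or.inr)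
    · have hag : a.1 = g.1 := (mem_walkEdges_cons.1 ha).resolve_right ha'
      rcases eq_or_eq_rev_of_fst_eq hag with rfl | rfl
      · exact ⟨rev g₁, by simp, by rw [base_rev, hf.1], hf.2.symm⟩
      · exact absurd rfl hg

theorem NBWalk.noLeafExcept_of_closed (hw : G.NBWalk h (g :: l)) (ht : G.tip g = G.base h) :
    G.NoLeafExcept (walkEdges (g :: l)) (G.base h) := fun a ha hb =>
  hw.exists_ne_base_eq ha hb (by rintro rfl; exact hb (by simpa using ht))

theorem NBWalk.noLeafExcept_union (hw : G.NBWalk h (g :: l)) (hw' : G.NBWalk h (g' :: l'))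
    (ht : G.tip g = G.tip g') (hne : g ≠ g') :
    G.NoLeafExcept (walkEdges (g :: l) ∪ walkEdges (g' :: l')) (G.base h) := by
  intro a ha hb
  simp only [Finset.mem_union] at ha ⊢
  rcases ha with ha | ha
  · by_cases hag : a = rev g
    · subst hag
      exact ⟨rev g', Or.inr (by simp), by simp [ht], rev_injective.ne hne.symm⟩
    · exact (hw.exists_ne_base_eq ha hb hag).imp fun _ => And.imp_left Or.inl
  · by_cases hag : a = rev g'
    · subst hag
      exact ⟨rev g, Or.inl (by simp), by simp [ht], rev_injective.ne hne⟩
    · exact (hw'.exists_ne_base_eq ha hb hag).imp fun _ => And.imp_left Or.inr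

end walkEdges

section ExistsNoLeaf

variable {h g g' : E × Bool} {l l' : List (E × Bool)}

theorem NBWalk.exists_noLeafExcept_of_closed (hw : G.NBWalk h (g :: l))
    (ht : G.tip g = G.base h) :
    ∃ F : Finset E, F.card ≤ l.length + 1 ∧ h.1 ∈ F ∧ G.NoLeafExcept F (G.base h) := by
  classical
  exact ⟨_, card_walkEdges_le _, hw.fst_mem_walkEdges, hw.noLeafExcept_of_closed ht⟩

theorem NBWalk.exists_noLeafExcept_of_ne (hw : G.NBWalk h (g :: l)) (hw' : G.NBWalk h (g' :: l'))
    (ht : G.tip g = G.tip g') (hne : g ≠ g') :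
    ∃ F : Finset E, F.card ≤ (l.length + 1) + (l'.length + 1) ∧ h.1 ∈ F ∧
      G.NoLeafExcept F (G.base h) := by
  classical
  exact ⟨_, (Finset.card_union_le _ _).trans
    (add_le_add (card_walkEdges_le _) (card_walkEdges_le _)),
    Finset.mem_union_left _ hw.fst_mem_walkEdges, hw.noLeafExcept_union hw' ht hne⟩

-- Common last steps are removed until the walks differ in the last step or one of them is a single
-- step, in which case the other one returns to the start.
theorem NBWalk.exists_noLeafExcept (hw : G.NBWalk h (g :: l)) (hw' : G.NBWalk h (g' :: l'))
    (ht : G.tip g = G.tip g') (hne : g :: l ≠ g' :: l') :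
    ∃ F : Finset E, F.card ≤ (l.length + 1) + (l'.length + 1) ∧ h.1 ∈ F ∧
      G.NoLeafExcept F (G.base h) := by
  induction l generalizing g g' l' with
  | nil =>
    obtain hg | rfl := ne_or_eq g g'
    · exact hw.exists_noLeafExcept_of_ne hw' ht hg
    obtain rfl : g = h := by cases hw; rfl
    cases hw' with
    | single => exact absurd rfl hne
    | cons hw₁' hf' =>
      obtain ⟨F, hcard, hF⟩ := hw₁'.exists_noLeafExcept_of_closed hf'.1.symm
      exact ⟨F, by simp only [List.length_cons]; lia, hF⟩
  | cons g₁ l₁ ih =>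
    obtain hg | rfl := ne_or_eq g g'
    · exact hw.exists_noLeafExcept_of_ne hw' ht hg
    obtain ⟨hw₁, hf⟩ : G.NBWalk h (g₁ :: l₁) ∧ G.Follows g₁ g := by
      cases hw with | cons hw₁ hf => exact ⟨hw₁, hf⟩
    cases hw' with
    | single =>
      obtain ⟨F, hcard, hF⟩ := hw₁.exists_noLeafExcept_of_closed hf.1.symm
      exact ⟨F, by simp only [List.length_cons]; lia, hF⟩
    | cons hw₁' hf' =>
      obtain ⟨F, hcard, hF⟩ := ih hw₁ hw₁' (hf.1.symm.trans hf'.1) fun h => hne (by rw [h])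
      exact ⟨F, by simp only [List.length_cons]; lia, hF⟩

theorem exists_noLeafExcept_of_not_treeLike {L : ℕ} (hc : ¬ G.TreeLike L h) :
    ∃ F : Finset E, F.card ≤ 2 * L ∧ h.1 ∈ F ∧ G.NoLeafExcept F (G.base h) := by
  unfold TreeLike at hc
  push Not at hc
  obtain ⟨g, g', l, l', hw, hw', hl, hl', ht, hne⟩ := hc
  obtain ⟨F, hcard, hF⟩ := hw.exists_noLeafExcept hw' ht hne
  exact ⟨F, by lia, hF⟩

end ExistsNoLeaf

section HasExcess

variable [DecidableEq V]

/-- The degree of `v` in the graph with edge set `F`. -/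
def degreeIn (G : Multigraph V E) (F : Finset E) (v : V) : ℕ :=
  ((F ×ˢ Finset.univ).filter fun a => G.base a = v).card

/-- There is a set of at most `M` edges in which `v` has degree at least three and which has no
leaves other than `v`. -/
def HasExcess (G : Multigraph V E) (M : ℕ) (v : V) : Prop :=
  ∃ F : Finset E, F.card ≤ M ∧ G.NoLeafExcept F v ∧ 2 < G.degreeIn F v

theorem NoLeafExcept.one_lt_degreeIn {F : Finset E} {v : V} (h : G.NoLeafExcept F v)
    {a : E × Bool} (ha : a.1 ∈ F) (hv : G.base a ≠ v) : 1 < G.degreeIn F (G.base a) := by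
  obtain ⟨b, hb, hba, hne⟩ := h a ha hv
  exact Finset.one_lt_card.2 ⟨b, by simp [hb, hba], a, by simp [ha], hne⟩

theorem card_not_treeLike_le_two [Fintype E] {L : ℕ} {v : V} [DecidablePred (G.TreeLike L)]
    (hv : ¬ G.HasExcess (6 * L) v) :
    ((G.halfEdgesAt v).filter fun h => ¬ G.TreeLike L h).card ≤ 2 := by
  classical
  by_contra! hlt
  obtain ⟨a, ha, b, hb, c, hc, hne⟩ := Finset.two_lt_card.1 hlt
  simp only [Finset.mem_filter, halfEdgesAt, Finset.mem_univ, true_and] at ha hb hc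
  obtain ⟨Fa, cardA, memA, leafA⟩ := exists_noLeafExcept_of_not_treeLike ha.2
  obtain ⟨Fb, cardB, memB, leafB⟩ := exists_noLeafExcept_of_not_treeLike hb.2
  obtain ⟨Fc, cardC, memC, leafC⟩ := exists_noLeafExcept_of_not_treeLike hc.2
  rw [ha.1] at leafA
  rw [hb.1] at leafB
  rw [hc.1] at leafC
  refine hv ⟨Fa ∪ Fb ∪ Fc, ?_, (leafA.union leafB).union leafC, Finset.two_lt_card.2
    ⟨a, by simp [memA, ha.1], b, by simp [memB, hb.1], c, by simp [memC, hc.1], hne⟩⟩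
  have := Finset.card_union_le (Fa ∪ Fb) Fc
  have := Finset.card_union_le Fa Fb
  lia

end HasExcess

end Multigraph

/-! ### Counting edge sets without leaves -/

section Sums

variable {ι α β : Type*} [DecidableEq β]

theorem prod_comp_le_mul_prod_image_sq [Fintype ι] {f : ι → β} {w : β → ℝ} (hw₀ : ∀ x, 0 ≤ w x)
    (hw₁ : ∀ x, w x ≤ 1) {v : β}
    (hfiber : ∀ q, f q ≠ v → 1 < (Finset.univ.filter fun p => f p = f q).card)
    (hv : 2 < (Finset.univ.filter fun p => f p = v).card) :
    ∏ q, w (f q) ≤ w v * ∏ x ∈ Finset.univ.image f, w x ^ 2 := by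
  have hv_mem : v ∈ Finset.univ.image f := by
    obtain ⟨q, hq⟩ := Finset.card_pos.1 (zero_le_two.trans_lt hv)
    exact Finset.mem_image.2 ⟨q, Finset.mem_univ q, (Finset.mem_filter.1 hq).2⟩
  have hfactor : ∀ x ∈ Finset.univ.image f,
      w x ^ (Finset.univ.filter fun p => f p = x).card ≤ (if x = v then w v else 1) * w x ^ 2 := by
    intro x hx
    obtain ⟨q, -, rfl⟩ := Finset.mem_image.1 hx
    by_cases hq : f q = v
    · rw [if_pos hq, hq, ← pow_succ']
      exact pow_le_pow_of_le_one (hw₀ v) (hw₁ v) hv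
    · rw [if_neg hq, one_mul]
      exact pow_le_pow_of_le_one (hw₀ _) (hw₁ _) (hfiber q hq)
  rw [Finset.prod_comp]
  refine (Finset.prod_le_prod (fun x _ => pow_nonneg (hw₀ x) _) hfactor).trans (le_of_eq ?_)
  rw [Finset.prod_mul_distrib, Finset.prod_ite_eq', if_pos hv_mem]

variable [Fintype α] [Fintype β] {f : α → β} {c : ℕ}
  (hf : ∀ x, (Finset.univ.filter fun a => f a = x).card ≤ c) {w : β → ℝ} (hw : ∀ x, 0 ≤ w x)
include hf hw

theorem sum_comp_le_mul_sum : ∑ a, w (f a) ≤ c * ∑ x, w x := by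
  rw [← Finset.sum_fiberwise' Finset.univ f w, Finset.mul_sum]
  refine Finset.sum_le_sum fun x _ => ?_
  rw [Finset.sum_const, nsmul_eq_mul]
  exact mul_le_mul_of_nonneg_right (Nat.cast_le.2 (hf x)) (hw x)

theorem sum_prod_insert_le (S : Finset β) :
    ∑ a, ∏ x ∈ insert (f a) S, w x ≤ (∏ x ∈ S, w x) * (c * (∑ x, w x + S.card)) := by
  have hS : 0 ≤ ∏ x ∈ S, w x := Finset.prod_nonneg fun x _ => hw x
  calc ∑ a, ∏ x ∈ insert (f a) S, w x
      ≤ ∑ a, (∏ x ∈ S, w x) * (w (f a) + if f a ∈ S then 1 else 0) := by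
        refine Finset.sum_le_sum fun a _ => ?_
        have := hw (f a)
        by_cases ha : f a ∈ S
        · rw [Finset.insert_eq_of_mem ha, if_pos ha]
          exact le_mul_of_one_le_right hS (by linarith)
        · rw [Finset.prod_insert ha, if_neg ha, add_zero, mul_comm]
    _ ≤ (∏ x ∈ S, w x) * (c * ∑ x, (w x + if x ∈ S then 1 else 0)) := by
        rw [← Finset.mul_sum]
        gcongr
        refine sum_comp_le_mul_sum hf (w := fun x => w x + if x ∈ S then 1 else 0) fun x => ?_
        have := hw x
        positivity
    _ = _ := by
        rw [Finset.sum_add_distrib]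
        simp

theorem sum_prod_image_fin_le (N : ℕ) :
    ∑ z : Fin N → α, ∏ x ∈ Finset.univ.image (f ∘ z), w x ≤ (c * (∑ x, w x + N)) ^ N := by
  have hW : 0 ≤ ∑ x, w x := Finset.sum_nonneg fun x _ => hw x
  induction N with
  | zero => simp
  | succ N ih =>
    have himage (z : Fin N → α) (a : α) :
        Finset.univ.image (f ∘ (Fin.consEquiv fun _ : Fin (N + 1) => α) (a, z))
          = insert (f a) (Finset.univ.image (f ∘ z)) := by
      ext x
      simp only [Finset.mem_image, Finset.mem_univ, true_and, Finset.mem_insert,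
        Function.comp_apply, Fin.consEquiv_apply, Fin.exists_fin_succ, Fin.cons_zero, Fin.cons_succ]
      exact or_congr_left eq_comm
    rw [← (Fin.consEquiv fun _ : Fin (N + 1) => α).sum_comp, Fintype.sum_prod_type_right]
    simp only [himage]
    calc _ ≤ ∑ z : Fin N → α, (∏ x ∈ Finset.univ.image (f ∘ z), w x) *
          (c * (∑ x, w x + (N + 1 : ℕ))) := by
          refine Finset.sum_le_sum fun z _ => (sum_prod_insert_le hf hw _).trans ?_
          have hcard : (Finset.univ.image (f ∘ z)).card ≤ N + 1 :=
            Finset.card_image_le.trans (by simp)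
          have := Finset.prod_nonneg fun x (_ : x ∈ Finset.univ.image (f ∘ z)) => hw x
          gcongr
      _ ≤ (c * (∑ x, w x + N)) ^ N * (c * (∑ x, w x + (N + 1 : ℕ))) := by
          rw [← Finset.sum_mul]
          gcongr
      _ ≤ _ := by
          rw [pow_succ]
          gcongr
          simp

theorem sum_prod_image_le [Fintype ι] [DecidableEq ι] :
    ∑ z : ι → α, ∏ x ∈ Finset.univ.image (f ∘ z), w x
      ≤ (c * (∑ x, w x + Fintype.card ι)) ^ Fintype.card ι := by
  refine le_trans (le_of_eq ?_) (sum_prod_image_fin_le hf hw (Fintype.card ι))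
  refine Fintype.sum_equiv ((Fintype.equivFin ι).arrowCongr (Equiv.refl α)) _ _ fun z => ?_
  congr 1
  ext x
  simp only [Finset.mem_image, Finset.mem_univ, true_and, Function.comp_apply,
    Equiv.arrowCongr_apply, Equiv.coe_refl, id]
  exact (Fintype.equivFin ι).symm.surjective.exists

end Sums

theorem card_filter_divNat_eq {t m : ℕ} (x : Fin t) :
    (Finset.univ.filter fun a : Fin (t * m) => a.divNat = x).card = m := by
  have hdiv (y : Fin t) (b : Fin m) : (finProdFinEquiv (y, b)).divNat = y :=
    congrArg Prod.fst (finProdFinEquiv.symm_apply_apply (y, b))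
  rw [Finset.card_filter, ← finProdFinEquiv.sum_comp, Fintype.sum_prod_type]
  simp [hdiv]

section Excess

variable {t m r : ℕ}

/-- The ends `z` of a sequence of edges of `PA_{tm}(1, δ)` become, after the contraction, the ends
of a graph without leaves other than a vertex of number larger than `κ` and degree at least
three. -/
def ExcessPattern (κ : ℝ) (z : Fin r × Bool → Fin (t * m)) : Prop :=
  Function.Injective (fun s => z (s, false)) ∧ (∀ s, z (s, true) ≤ z (s, false)) ∧
    ∃ v : Fin t, κ < (v : ℕ) + 1 ∧
      (∀ q, (z q).divNat ≠ v →
        1 < (Finset.univ.filter fun p => (z p).divNat = (z q).divNat).card) ∧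
      2 < (Finset.univ.filter fun p => (z p).divNat = v).card

theorem ExcessPattern.prod_le {κ : ℝ} (hκ : 0 < κ) {z : Fin r × Bool → Fin (t * m)}
    (hz : ExcessPattern κ z) :
    ∏ q, (√((z q : ℕ) + 1))⁻¹ ≤
      (√κ)⁻¹ * ∏ x ∈ Finset.univ.image (Fin.divNat ∘ z), (((x : ℕ) : ℝ) + 1)⁻¹ := by
  obtain ⟨-, -, v, hv, hfiber, hfiber_v⟩ := hz
  set w : Fin t → ℝ := fun x => (√(((x : ℕ) : ℝ) + 1))⁻¹
  have hw₁ (x : Fin t) : w x ≤ 1 := inv_le_one_of_one_le₀ (Real.one_le_sqrt.2 (by simp))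
  have hw_sq (x : Fin t) : w x ^ 2 = (((x : ℕ) : ℝ) + 1)⁻¹ := by
    rw [inv_pow, Real.sq_sqrt (by positivity)]
  have hdiv (q : Fin r × Bool) : ((z q).divNat : ℕ) ≤ z q := Nat.div_le_self _ _
  calc ∏ q, (√((z q : ℕ) + 1))⁻¹ ≤ ∏ q, w ((Fin.divNat ∘ z) q) := by
        refine Finset.prod_le_prod (fun q _ => by positivity) fun q _ => ?_
        simp only [w, Function.comp_apply]
        gcongr
        exact hdiv q
    _ ≤ w v * ∏ x ∈ Finset.univ.image (Fin.divNat ∘ z), w x ^ 2 :=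
        prod_comp_le_mul_prod_image_sq (fun x => by positivity) hw₁ hfiber hfiber_v
    _ ≤ _ := by
        simp only [hw_sq]
        gcongr
        exact inv_anti₀ (Real.sqrt_pos.2 hκ) (Real.sqrt_le_sqrt hv.le)

theorem measureReal_edges_le {N : ℕ} (δ : ℝ≥0) {z : Fin r × Bool → Fin N}
    (hinj : Function.Injective fun s => z (s, false)) (hle : ∀ s, z (s, true) ≤ z (s, false)) :
    (paTreeLaw δ N).toMeasure.real {e | ∀ s, (e (z (s, false)) : ℕ) = z (s, true)}
      ≤ (r + 1) ^ r * ∏ q, (√((z q : ℕ) + 1))⁻¹ := by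
  set J : Fin r → ℕ := fun s => (z (s, false) : ℕ)
  have hJ : Function.Injective J := Fin.val_injective.comp hinj
  set g : ℕ → ℕ := Function.extend J (fun s => (z (s, true) : ℕ)) id
  have hgJ (s : Fin r) : g (J s) = z (s, true) := hJ.extend_apply _ _ s
  have hcard : (Finset.univ.image J).card = r := by
    rw [Finset.card_image_of_injective _ hJ, Finset.card_univ, Fintype.card_fin]
  have hrange : Finset.univ.image J ⊆ Finset.range N :=
    Finset.image_subset_iff.2 fun s _ => Finset.mem_range.2 (z (s, false)).isLt
  have hg : ∀ j ∈ Finset.univ.image J, g j ≤ j :=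
    Finset.forall_mem_image.2 fun s _ => (hgJ s).trans_le (hle s)
  have hattached : {e : PATree N | ∀ s, (e (z (s, false)) : ℕ) = z (s, true)}
      ⊆ {e | AttachedAs (Finset.univ.image J) g e} := by
    intro e he j hj
    obtain ⟨s, -, hs⟩ := Finset.mem_image.1 hj
    obtain rfl : z (s, false) = j := Fin.ext hs
    exact (he s).trans (hgJ s).symm
  refine (measureReal_mono hattached).trans
    ((paTreeLaw_attachedAs_le_prod δ hrange hg).trans (le_of_eq ?_))
  rw [hcard, Finset.prod_image hJ.injOn, Finset.prod_mul_distrib, Finset.prod_const,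
    Fintype.prod_prod_type]
  simp only [Fintype.prod_bool, hgJ, Finset.card_univ, Fintype.card_fin]
  congr 1
  exact Finset.prod_congr rfl fun s _ => mul_comm _ _

theorem exists_excessPattern {M : ℕ} {κ : ℝ} {e : PATree (t * m)} {v : Fin t}
    (hv : κ < (v : ℕ) + 1) (hex : (paGraph e).HasExcess M v) :
    ∃ r ≤ M, ∃ z : Fin r × Bool → Fin (t * m), ExcessPattern κ z ∧
      ∀ s, (e (z (s, false)) : ℕ) = z (s, true) := by
  obtain ⟨F, hF, hleaf, hdeg⟩ := hex
  set φ : Fin F.card ≃ F := F.equivFin.symm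
  set z : Fin F.card × Bool → Fin (t * m) := fun q =>
    if q.2 then Fin.castLE (φ q.1 : Fin (t * m)).isLt (e (φ q.1)) else φ q.1
  have hbase (q : Fin F.card × Bool) : (paGraph e).base (φ q.1, q.2) = (z q).divNat := by
    rcases q with ⟨s, _ | _⟩ <;> rfl
  have hdegreeIn (u : Fin t) : (paGraph e).degreeIn F u
      = (Finset.univ.filter fun p => (z p).divNat = u).card := by
    symm
    refine Finset.card_bij (fun q _ => ((φ q.1 : Fin (t * m)), q.2)) ?_ ?_ ?_
    · intro q hq
      simpa [hbase] using hq
    · rintro ⟨s, b⟩ - ⟨s', b'⟩ - h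
      simpa [Subtype.ext_iff] using h
    · rintro ⟨j, b⟩ hj
      obtain ⟨hjF, hju⟩ : j ∈ F ∧ (paGraph e).base (j, b) = u := by simpa using hj
      refine ⟨(φ.symm ⟨j, hjF⟩, b), ?_, by simp⟩
      simp [← hbase, hju]
  refine ⟨F.card, hF, z, ⟨fun s s' h => φ.injective (Subtype.ext h), fun s => ?_, v, hv, ?_, ?_⟩,
    fun s => rfl⟩
  · exact Fin.le_iff_val_le_val.2 (Nat.le_of_lt_succ (e (φ s)).isLt)
  · intro q hq
    rw [← hbase] at hq
    rw [← hdegreeIn, ← hbase]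
    exact hleaf.one_lt_degreeIn (φ q.1).2 hq
  · rwa [← hdegreeIn]

open Classical in
theorem sum_excessPattern_measureReal_le (δ : ℝ≥0) {κ : ℝ} (hκ : 0 < κ) :
    ∑ z : Fin r × Bool → Fin (t * m) with ExcessPattern κ z,
        (paTreeLaw δ (t * m)).toMeasure.real {e | ∀ s, (e (z (s, false)) : ℕ) = z (s, true)}
      ≤ (r + 1) ^ r * ((√κ)⁻¹ *
          (m * (∑ x : Fin t, (((x : ℕ) : ℝ) + 1)⁻¹ + (2 * r : ℕ))) ^ (2 * r)) := by
  have hcard : Fintype.card (Fin r × Bool) = 2 * r := by simp [mul_comm]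
  calc _ ≤ ∑ z : Fin r × Bool → Fin (t * m) with ExcessPattern κ z, ((r : ℝ) + 1) ^ r * ((√κ)⁻¹ *
          ∏ x ∈ Finset.univ.image (Fin.divNat ∘ z), (((x : ℕ) : ℝ) + 1)⁻¹) := by
        refine Finset.sum_le_sum fun z hz => ?_
        have hz' : ExcessPattern κ z := (Finset.mem_filter.1 hz).2
        refine (measureReal_edges_le δ hz'.1 hz'.2.1).trans ?_
        gcongr
        exact hz'.prod_le hκ
    _ ≤ ∑ z : Fin r × Bool → Fin (t * m), ((r : ℝ) + 1) ^ r * ((√κ)⁻¹ *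
          ∏ x ∈ Finset.univ.image (Fin.divNat ∘ z), (((x : ℕ) : ℝ) + 1)⁻¹) :=
        Finset.sum_le_univ_sum_of_nonneg fun z =>
          mul_nonneg (by positivity) (mul_nonneg (by positivity)
            (Finset.prod_nonneg fun x _ => by positivity))
    _ ≤ _ := by
        rw [← Finset.mul_sum, ← Finset.mul_sum, ← hcard]
        gcongr
        exact sum_prod_image_le (fun x => (card_filter_divNat_eq x).le) fun x => by positivity

theorem measureReal_hasExcess_le (δ : ℝ≥0) (t m M : ℕ) {κ : ℝ} (hκ : 0 < κ) :
    (paTreeLaw δ (t * m)).toMeasure.real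
        {e | ∃ v : Fin t, κ < (v : ℕ) + 1 ∧ (paGraph e).HasExcess M v}
      ≤ ∑ r ∈ Finset.range (M + 1), (r + 1) ^ r * ((√κ)⁻¹ *
          (m * (∑ x : Fin t, (((x : ℕ) : ℝ) + 1)⁻¹ + (2 * r : ℕ))) ^ (2 * r)) := by
  classical
  have hcover : {e : PATree (t * m) | ∃ v : Fin t, κ < (v : ℕ) + 1 ∧ (paGraph e).HasExcess M v}
      ⊆ ⋃ r ∈ Finset.range (M + 1),
        ⋃ z ∈ Finset.univ.filter fun z : Fin r × Bool → Fin (t * m) => ExcessPattern κ z,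
          {e | ∀ s, (e (z (s, false)) : ℕ) = z (s, true)} := by
    rintro e ⟨v, hv, hex⟩
    obtain ⟨r, hr, z, hz, hez⟩ := exists_excessPattern hv hex
    simp only [Set.mem_iUnion, Finset.mem_range, Finset.mem_filter, Finset.mem_univ, true_and]
    exact ⟨r, Nat.lt_succ_of_le hr, z, hz, hez⟩
  refine (measureReal_mono hcover (measure_ne_top _ _)).trans ?_
  refine (measureReal_biUnion_finset_le _ _).trans (Finset.sum_le_sum fun r _ => ?_)
  exact (measureReal_biUnion_finset_le _ _).trans (sum_excessPattern_measureReal_le δ hκ)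

end Excess

/-! ### Blue vertices outside the outer core -/

section Typical

variable {V E : Type*} [Fintype E] [DecidableEq V] {G : Multigraph V E} {k L : ℕ} {S : Finset ℕ}

/-- The outcome `ω` of the protocol is typical for the time steps in `S` if the guarded colours of
all half-edges with a tree-like neighbourhood of radius `L` are blue then. The polls, which are
only almost surely admissible, are required to be so as well. -/
def IsTypical (G : Multigraph V E) (k L : ℕ) (S : Finset ℕ) (ω : Sample V E) : Prop :=
  (∀ s ∈ S, ∀ h, G.TreeLike L h → guardedColour G ω s h = false) ∧
    ∀ p, ω.2 p ∈ (G.halfEdgesAt p.2).powersetCard (pollSize G k p.2)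

theorem measurableSet_isTypical [Countable V] :
    MeasurableSet {ω : Sample V E | IsTypical G k L S ω} := by
  have hblue (s : ℕ) (h : E × Bool) : MeasurableSet {ω | guardedColour G ω s h = false} :=
    (measurable_guardedColour G s h).mono (localAlgebra_le _) le_rfl (.singleton false)
  have hpoll (p : ℕ × V) : MeasurableSet {ω : Sample V E |
      ω.2 p ∈ (G.halfEdgesAt p.2).powersetCard (pollSize G k p.2)} :=
    ((measurable_pi_apply p).comp measurable_snd)
      (Finset.measurableSet ((G.halfEdgesAt p.2).powersetCard (pollSize G k p.2)))
  simp only [IsTypical, Set.ofPred_and, Set.ofPred_forall]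
  exact (Finset.measurableSet_biInter _ fun s _ =>
    MeasurableSet.iInter fun h => MeasurableSet.iInter fun _ => hblue s h).inter
      (MeasurableSet.iInter hpoll)

/-- At most two of the neighbours polled by `v` can be red, and there are at least five of them. -/
theorem IsTypical.colour_succ_eq_false {ω : Sample V E} {T : ℕ} {v : V}
    (hω : IsTypical G k L S ω) (hT : T ∈ S) (hv : ¬ G.HasExcess (6 * L) v)
    (hpoll : 5 ≤ pollSize G k v) : colour G ω.1 ω.2 (T + 1) v = false := by
  classical
  obtain ⟨hsub, hcard⟩ := Finset.mem_powersetCard.1 (hω.2 (T + 1, v))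
  have hred : ((ω.2 (T + 1, v)).filter fun h => colour G ω.1 ω.2 T (G.tip h) = true)
      ⊆ (G.halfEdgesAt v).filter fun h => ¬ G.TreeLike L h := by
    intro h hh
    obtain ⟨hmem, hcol⟩ := Finset.mem_filter.1 hh
    refine Finset.mem_filter.2 ⟨hsub hmem, fun htree => ?_⟩
    simpa [hω.1 T hT h htree] using guardedColour_of_colour hcol
  have hred_card := (Finset.card_le_card hred).trans (card_not_treeLike_le_two hv)
  simp only [colour, decide_eq_false_iff_not, not_lt]
  lia

variable [Fintype V]

theorem ae_poll_mem (G : Multigraph V E) (k : ℕ) (α : unitInterval) :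
    ∀ᵐ ω ∂protocolLaw G k α, ∀ p, ω.2 p ∈ (G.halfEdgesAt p.2).powersetCard (pollSize G k p.2) := by
  refine ae_all_iff.2 fun p => ?_
  have hne (Q : Finset (E × Bool)) (hQ : Q ∉ (G.halfEdgesAt p.2).powersetCard (pollSize G k p.2)) :
      ∀ᵐ ω ∂protocolLaw G k α, ω.2 p ≠ Q := by
    have := measureReal_poll_eq G k α p Q
    rw [pollLaw_eq_zero G k p.2 hQ, ENNReal.toReal_zero, measureReal_eq_zero_iff] at this
    simpa [ae_iff] using this
  filter_upwards [ae_all_iff.2 fun Q => ae_all_iff.2 (hne Q)] with ω hω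
  by_contra hQ
  exact hω _ hQ rfl

theorem measureReal_exists_guardedColour_le {h a : ℕ} {α : unitInterval} (hh : 2 ≤ h)
    (hα : (α : ℝ) < alphaStar (2 * h + 1))
    (hpoll : ∀ v, ∃ i, h ≤ i ∧ pollSize G k v = 2 * i + 1) (hS : ∀ s ∈ S, a ≤ s ∧ s + 1 ≤ L) :
    (protocolLaw G k α).real
        {ω | ∃ s ∈ S, ∃ h₀, G.TreeLike L h₀ ∧ guardedColour G ω s h₀ = true}
      ≤ S.card * (2 * Fintype.card E) * redSeq h α a := by
  classical
  set P := S ×ˢ Finset.univ.filter fun h₀ => G.TreeLike L h₀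
  have hcover : {ω | ∃ s ∈ S, ∃ h₀, G.TreeLike L h₀ ∧ guardedColour G ω s h₀ = true}
      ⊆ ⋃ q ∈ P, {ω | guardedColour G ω q.1 q.2 = true} := by
    rintro ω ⟨s, hs, h₀, htree, hred⟩
    exact Set.mem_biUnion (x := (s, h₀)) (by simpa [P] using ⟨hs, htree⟩) hred
  have hP : ∀ q ∈ P,
      (protocolLaw G k α).real {ω | guardedColour G ω q.1 q.2 = true} ≤ redSeq h α a := by
    rintro ⟨s, h₀⟩ hq
    obtain ⟨hs, htree⟩ : s ∈ S ∧ G.TreeLike L h₀ := by simpa [P] using hq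
    exact (measureReal_guardedColour_le hh hα hpoll s (htree.mono (hS s hs).2)).trans
      (redSeq_antitone hh α.2.1 hα (hS s hs).1)
  have hcard : P.card ≤ S.card * (2 * Fintype.card E) := by
    rw [Finset.card_product]
    exact Nat.mul_le_mul_left _ ((Finset.card_filter_le _ _).trans (by simp [mul_comm]))
  have hnonneg : 0 ≤ redSeq h α a := (redSeq_mem_Icc hh α.2.1 hα a).1
  calc _ ≤ ∑ q ∈ P, (protocolLaw G k α).real {ω | guardedColour G ω q.1 q.2 = true} :=
        (measureReal_mono hcover (measure_ne_top _ _)).trans (measureReal_biUnion_finset_le _ _)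
    _ ≤ P.card • redSeq h α a := Finset.sum_le_card_nsmul _ _ _ hP
    _ ≤ _ := by
        rw [nsmul_eq_mul]
        gcongr
        exact_mod_cast hcard

theorem protocolLaw_not_isTypical_le {h a : ℕ} {α : unitInterval} (hh : 2 ≤ h)
    (hα : (α : ℝ) < alphaStar (2 * h + 1))
    (hpoll : ∀ v, ∃ i, h ≤ i ∧ pollSize G k v = 2 * i + 1) (hS : ∀ s ∈ S, a ≤ s ∧ s + 1 ≤ L) :
    protocolLaw G k α {ω | ¬ IsTypical G k L S ω}
      ≤ ENNReal.ofReal (S.card * (2 * Fintype.card E) * redSeq h α a) := by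
  refine le_trans (measure_mono_ae ?_) ((ofReal_measureReal).ge.trans
    (ENNReal.ofReal_le_ofReal (measureReal_exists_guardedColour_le hh hα hpoll hS)))
  filter_upwards [ae_poll_mem G k α] with ω hω hnot
  by_contra hblue
  refine hnot ⟨fun s hs h₀ htree => ?_, hω⟩
  by_contra hred
  exact hblue ⟨s, hs, h₀, htree, by simpa using hred⟩

end Typical

theorem le_degree_paGraph {m t : ℕ} (e : PATree (t * m)) (v : Fin t) :
    m ≤ (paGraph e).degree v := by
  have hsub : (Finset.univ.filter fun a : Fin (t * m) => a.divNat = v).image (·, false)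
      ⊆ (paGraph e).halfEdgesAt v := by
    intro q hq
    obtain ⟨a, ha, rfl⟩ := Finset.mem_image.1 hq
    exact Finset.mem_filter.2 ⟨Finset.mem_univ _, (Finset.mem_filter.1 ha).2⟩
  calc m = ((Finset.univ.filter fun a : Fin (t * m) => a.divNat = v).image (·, false)).card := by
        rw [Finset.card_image_of_injective _ (Prod.mk_left_injective false),
          card_filter_divNat_eq]
    _ ≤ _ := Finset.card_le_card hsub

theorem exists_dParam_eq {m k : ℕ} (hm : 5 ≤ m) (hk : 5 ≤ k) (hkodd : Odd k) :
    ∃ h, 2 ≤ h ∧ dParam m k = 2 * h + 1 := by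
  obtain ⟨a, rfl⟩ := hkodd
  unfold dParam
  split_ifs with hodd
  · obtain ⟨b, rfl⟩ := hodd
    exact ⟨min b a, by lia, by lia⟩
  · obtain ⟨b, rfl⟩ := Nat.not_odd_iff_even.1 hodd
    exact ⟨min (b - 1) a, by lia, by lia⟩

section PollSize

variable {V E : Type*} [Fintype E] [DecidableEq V] {G : Multigraph V E} {m k : ℕ} {v : V}

theorem dParam_le_pollSize (hdeg : m ≤ G.degree v) : dParam m k ≤ pollSize G k v := by
  unfold dParam pollSize
  split_ifs with hm hodd hodd
  · lia
  · have : G.degree v ≠ m := fun heq => hodd (heq ▸ hm)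
    lia
  · lia
  · lia

theorem odd_pollSize (hkodd : Odd k) (hdeg : 0 < G.degree v) : Odd (pollSize G k v) := by
  unfold pollSize
  rcases min_choice k (if Odd (G.degree v) then G.degree v else G.degree v - 1) with hmin | hmin
  · rwa [hmin]
  · rw [hmin]
    split_ifs with hodd
    · exact hodd
    · exact Nat.Even.sub_odd hdeg (Nat.not_odd_iff_even.1 hodd) odd_one

end PollSize

theorem exists_pollSize_paGraph_eq {m k h t : ℕ} (hm : 0 < m) (hkodd : Odd k)
    (hd : dParam m k = 2 * h + 1) (e : PATree (t * m)) (v : Fin t) :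
    ∃ i, h ≤ i ∧ pollSize (paGraph e) k v = 2 * i + 1 := by
  have hdeg := le_degree_paGraph e v
  obtain ⟨i, hi⟩ := odd_pollSize hkodd (hm.trans_le hdeg)
  have := dParam_le_pollSize (k := k) hdeg
  exact ⟨i, by lia, hi⟩

section JointLaw

variable {m k t : ℕ} {δ : ℝ≥0} {α : unitInterval}

instance (m k t : ℕ) (α : unitInterval) : IsMarkovKernel (Kernel.ofFunOfCountable
    fun e : PATree (t * m) => protocolLaw (paGraph e) k α) :=
  ⟨fun e => inferInstanceAs (IsProbabilityMeasure (protocolLaw (paGraph e) k α))⟩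

theorem jointLaw_fst_mem (X : Set (PATree (t * m))) :
    jointLaw m k δ α t {x | x.1 ∈ X} = (paTreeLaw (δ / m) (t * m)).toMeasure X := by
  rw [← Measure.fst_compProd (paTreeLaw (δ / m) (t * m)).toMeasure
    (Kernel.ofFunOfCountable fun e : PATree (t * m) => protocolLaw (paGraph e) k α),
    Measure.fst_apply (Set.toFinite X).measurableSet]
  rfl

theorem jointLaw_le_of_forall {D : PATree (t * m) → Set (Sample (Fin t) (Fin (t * m)))}
    (hD : ∀ e, MeasurableSet (D e)) {c : ℝ≥0∞}
    (hc : ∀ e, protocolLaw (paGraph e) k α (D e) ≤ c) :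
    jointLaw m k δ α t {x | x.2 ∈ D x.1} ≤ c := by
  have hmeas : MeasurableSet {x : PATree (t * m) × Sample (Fin t) (Fin (t * m)) | x.2 ∈ D x.1} := by
    have : {x : PATree (t * m) × Sample (Fin t) (Fin (t * m)) | x.2 ∈ D x.1}
        = ⋃ e, {e} ×ˢ D e := by
      ext ⟨e, ω⟩
      simp
    rw [this]
    exact MeasurableSet.iUnion fun e => (MeasurableSet.singleton e).prod (hD e)
  rw [jointLaw, Measure.compProd_apply hmeas]
  exact (lintegral_mono hc).trans (by simp)

theorem jointLaw_not_blueOutsideCore_le {h : ℕ} (hm : 0 < m) (hkodd : Odd k)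
    (hd : dParam m k = 2 * h + 1) (hh : 2 ≤ h) (A : ℝ) (hα : (α : ℝ) < alphaStar (2 * h + 1))
    {S : Finset ℕ} {a L : ℕ} (hS : ∀ s ∈ S, a ≤ s ∧ s + 1 ≤ L) :
    jointLaw m k δ α t {x | ¬ ∀ s ∈ S, BlueOutsideCore A x.1 x.2.1 x.2.2 (s + 1)}
      ≤ (paTreeLaw (δ / m) (t * m)).toMeasure
          {e | ∃ v : Fin t, kappaO A t < (v : ℕ) + 1 ∧ (paGraph e).HasExcess (6 * L) v}
        + ENNReal.ofReal (S.card * (2 * (t * m : ℕ)) * redSeq h α a) := by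
  have hpoll (e : PATree (t * m)) := exists_pollSize_paGraph_eq hm hkodd hd e
  have hcover : {x : PATree (t * m) × Sample (Fin t) (Fin (t * m)) |
        ¬ ∀ s ∈ S, BlueOutsideCore A x.1 x.2.1 x.2.2 (s + 1)}
      ⊆ {x | x.1 ∈ {e | ∃ v : Fin t, kappaO A t < (v : ℕ) + 1 ∧
          (paGraph e).HasExcess (6 * L) v}} ∪
        {x | x.2 ∈ {ω | ¬ IsTypical (paGraph x.1) k L S ω}} := by
    intro x hx
    by_contra hgood
    simp only [Set.mem_union, Set.mem_ofPred_eq, not_or, not_not, not_exists, not_and] at hgood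
    refine hx fun s hs v hv => hgood.2.colour_succ_eq_false hs (hgood.1 v hv) ?_
    obtain ⟨i, hi, hsize⟩ := hpoll x.1 v
    lia
  refine (measure_mono hcover).trans ((measure_union_le _ _).trans ?_)
  rw [jointLaw_fst_mem]
  gcongr
  refine jointLaw_le_of_forall (fun e => measurableSet_isTypical.compl) fun e => ?_
  refine (protocolLaw_not_isTypical_le hh hα (hpoll e) hS).trans_eq ?_
  rw [Fintype.card_fin]

end JointLaw

/-! ### Asymptotics -/

theorem sum_inv_add_one_le_one_add_log (t : ℕ) :
    ∑ x : Fin t, (((x : ℕ) : ℝ) + 1)⁻¹ ≤ 1 + Real.log t := by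
  refine le_trans (le_of_eq ?_) (harmonic_le_one_add_log t)
  rw [harmonic, Fin.sum_univ_eq_sum_range fun x : ℕ => ((x : ℝ) + 1)⁻¹]
  push_cast
  rfl

theorem excess_term_le {m M r : ℕ} {x c H : ℝ} (hr : r ≤ M) (hM : (M : ℝ) + 1 ≤ x)
    (hm : 3 * (m : ℝ) ≤ x) (hH₀ : 0 ≤ H) (hH : H ≤ 1 + x) (hc : 0 ≤ c) :
    ((r : ℝ) + 1) ^ r * (c * (m * (H + (2 * r : ℕ))) ^ (2 * r)) ≤ x ^ (5 * M) * c := by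
  have hr' : (r : ℝ) ≤ M := Nat.cast_le.2 hr
  have hx : 1 ≤ x := by linarith [Nat.cast_nonneg (α := ℝ) M]
  have hbase : m * (H + (2 * r : ℕ)) ≤ x ^ 2 := by
    push_cast
    calc m * (H + 2 * r) ≤ m * (3 * x) := by gcongr; linarith
      _ = (3 * m) * x := by ring
      _ ≤ x * x := by gcongr
      _ = x ^ 2 := (sq x).symm
  calc ((r : ℝ) + 1) ^ r * (c * (m * (H + (2 * r : ℕ))) ^ (2 * r))
      ≤ x ^ r * (c * (x ^ 2) ^ (2 * r)) := by
        gcongr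
        linarith
    _ = x ^ (5 * r) * c := by ring
    _ ≤ x ^ (5 * M) * c := by gcongr

theorem measureReal_hasExcess_le_pow (δ : ℝ≥0) {t m M : ℕ} {κ : ℝ} (hκ : 0 < κ)
    (hM : (M : ℝ) + 1 ≤ Real.log t) (hm : 3 * (m : ℝ) ≤ Real.log t) :
    (paTreeLaw δ (t * m)).toMeasure.real
        {e | ∃ v : Fin t, κ < (v : ℕ) + 1 ∧ (paGraph e).HasExcess M v}
      ≤ Real.log t ^ (5 * M + 1) * (√κ)⁻¹ := by
  have hH : 0 ≤ ∑ x : Fin t, (((x : ℕ) : ℝ) + 1)⁻¹ := Finset.sum_nonneg fun x _ => by positivity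
  have : 0 ≤ Real.log t := by positivity
  refine (measureReal_hasExcess_le δ t m M hκ).trans
    ((Finset.sum_le_card_nsmul _ _ (Real.log t ^ (5 * M) * (√κ)⁻¹) fun r hr =>
      excess_term_le (Finset.mem_range_succ_iff.1 hr) hM hm hH (sum_inv_add_one_le_one_add_log t)
        (by positivity)).trans ?_)
  rw [Finset.card_range, nsmul_eq_mul, pow_succ', mul_assoc]
  push_cast
  gcongr

theorem inv_sqrt_kappaO {A : ℝ} {t : ℕ} (hx : 0 < Real.log t) :
    (√(kappaO A t))⁻¹ = Real.exp (-(999 / 2 * A * Real.log (Real.log t) ^ 2)) := by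
  rw [kappaO, omega, Real.sqrt_eq_rpow, ← Real.rpow_mul hx.le, Real.rpow_def_of_pos hx,
    ← Real.exp_neg]
  congr 1
  ring

theorem tendsto_log_natCast : Tendsto (fun t : ℕ => Real.log t) atTop atTop :=
  Real.tendsto_log_atTop.comp tendsto_natCast_atTop_atTop

theorem tendsto_log_log_natCast : Tendsto (fun t : ℕ => Real.log (Real.log t)) atTop atTop :=
  Real.tendsto_log_atTop.comp tendsto_log_natCast

theorem eventually_mul_log_log_add_one_le_log (C : ℝ) :
    ∀ᶠ t : ℕ in atTop, C * Real.log (Real.log t) + 1 ≤ Real.log t := by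
  have hlittle : (fun x : ℝ => C * Real.log x + 1) =o[atTop] id :=
    (Real.isLittleO_log_id_atTop.const_mul_left C).add (Asymptotics.isLittleO_const_id_atTop 1)
  refine tendsto_log_natCast.eventually (p := fun x => C * Real.log x + 1 ≤ x) ?_
  filter_upwards [hlittle.bound one_pos, eventually_ge_atTop 0] with x hx hx₀
  rw [one_mul, id, Real.norm_of_nonneg hx₀] at hx
  exact (Real.le_norm_self _).trans hx

/-- The probability is at most `(log t) ^ (5 M + 1) * κ_o ^ (-1 / 2)`, in which the two exponents
of `log t` are of order `5 C log log t` and `-(999 / 2) A log log t`. -/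
theorem tendsto_paTreeLaw_hasExcess (δ : ℝ≥0) (m : ℕ) {M : ℕ → ℕ} {A C : ℝ}
    (hM : ∀ᶠ t in atTop, (M t : ℝ) ≤ C * Real.log (Real.log t)) (hCA : 5 * C < 999 / 2 * A) :
    Tendsto (fun t : ℕ => (paTreeLaw δ (t * m)).toMeasure
      {e | ∃ v : Fin t, kappaO A t < (v : ℕ) + 1 ∧ (paGraph e).HasExcess (M t) v})
      atTop (𝓝 0) := by
  set c : ℝ := 999 / 2 * A - 5 * C
  have hexp : Tendsto (fun y : ℝ => Real.exp (-(y * (c * y - 1)))) atTop (𝓝 0) :=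
    Real.tendsto_exp_neg_atTop_nhds_zero.comp (tendsto_id.atTop_mul_atTop₀
      (tendsto_atTop_add_const_right _ (-1) (tendsto_id.const_mul_atTop (sub_pos.2 hCA))))
  have hreal : Tendsto (fun t : ℕ => (paTreeLaw δ (t * m)).toMeasure.real
      {e | ∃ v : Fin t, kappaO A t < (v : ℕ) + 1 ∧ (paGraph e).HasExcess (M t) v})
      atTop (𝓝 0) := by
    refine squeeze_zero' (.of_forall fun t => measureReal_nonneg) ?_
      (hexp.comp tendsto_log_log_natCast)
    filter_upwards [hM, tendsto_log_natCast.eventually_gt_atTop 0,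
      tendsto_log_natCast.eventually_ge_atTop (3 * (m : ℝ)),
      tendsto_log_log_natCast.eventually_ge_atTop 0, eventually_mul_log_log_add_one_le_log C]
      with t hMt hx hxm hy hyx
    have hκ : 0 < kappaO A t := Real.rpow_pos_of_pos hx _
    refine (measureReal_hasExcess_le_pow δ hκ (by linarith) hxm).trans ?_
    set y := Real.log (Real.log t)
    have hpow : Real.log t ^ (5 * M t + 1) = Real.exp ((5 * M t + 1) * y) := by
      rw [← Real.rpow_natCast, Real.rpow_def_of_pos hx, mul_comm]
      push_cast
      rfl
    rw [inv_sqrt_kappaO hx, hpow, ← Real.exp_add, Function.comp_apply, Real.exp_le_exp]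
    have : M t * y ≤ C * y * y := by gcongr
    simp only [c]
    linarith
  rw [← ENNReal.ofReal_zero]
  exact (ENNReal.tendsto_ofReal hreal).congr fun t => ofReal_measureReal

section TauStar

variable {h t : ℕ} {ε : ℝ} (hh : 2 ≤ h)
include hh

theorem one_le_log_two_mul_add_one : 1 ≤ Real.log (2 * h + 1 : ℕ) := by
  rw [Real.le_log_iff_exp_le (by positivity)]
  have : (2 : ℝ) ≤ h := Nat.ofNat_le_cast.2 hh
  push_cast
  linarith [Real.exp_one_lt_d9]

theorem log_natCast_pos : 0 < Real.log h :=
  Real.log_pos (Nat.one_lt_cast.2 hh)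

theorem tauStar_two_mul_add_one (ε : ℝ) (t : ℕ) :
    tauStar (2 * h + 1) ε t
      = (1 + ε) / Real.log h * Real.log (Real.log t / Real.log (2 * h + 1 : ℕ)) := by
  have hd : (((2 * h + 1 : ℕ) : ℝ) - 1) / 2 = h := by
    push_cast
    ring
  have hlogh := (log_natCast_pos hh).ne'
  have hlogd := (one_pos.trans_le (one_le_log_two_mul_add_one hh)).ne'
  rw [tauStar, hd]
  unfold Real.logb
  field_simp

theorem rpow_tauStar (ε : ℝ) (hx : 0 < Real.log t) :
    (h : ℝ) ^ tauStar (2 * h + 1) ε t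
      = (Real.log t / Real.log (2 * h + 1 : ℕ)) ^ (1 + ε) := by
  have hlogh := (log_natCast_pos hh).ne'
  have hlogd := one_pos.trans_le (one_le_log_two_mul_add_one hh)
  have hh₀ : (0 : ℝ) < h := Nat.cast_pos.2 (zero_lt_two.trans_le hh)
  rw [Real.rpow_def_of_pos hh₀, Real.rpow_def_of_pos (div_pos hx hlogd),
    tauStar_two_mul_add_one hh]
  congr 1
  field_simp

variable (hε : 0 < ε)
include hε

theorem tauStar_le (hx : 0 < Real.log t) :
    tauStar (2 * h + 1) ε t ≤ (1 + ε) / Real.log h * Real.log (Real.log t) := by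
  have hlogh := log_natCast_pos hh
  have hlogd := one_le_log_two_mul_add_one hh
  rw [tauStar_two_mul_add_one hh]
  gcongr
  exact div_le_self hx.le hlogd

theorem ceil_tauStar_add_two_le (hx : 0 < Real.log t) (hy : 1 ≤ Real.log (Real.log t)) :
    (⌈tauStar (2 * h + 1) ε t⌉₊ : ℝ) + 2
      ≤ ((1 + ε) / Real.log h + 3) * Real.log (Real.log t) := by
  have hlogh := log_natCast_pos hh
  have hceil : (⌈tauStar (2 * h + 1) ε t⌉₊ : ℝ)
      ≤ (1 + ε) / Real.log h * Real.log (Real.log t) + 1 :=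
    (Nat.cast_le.2 (Nat.ceil_mono (tauStar_le hh hε hx))).trans
      (Nat.ceil_lt_add_one (by positivity)).le
  linarith

theorem tendsto_tauStar : Tendsto (tauStar (2 * h + 1) ε) atTop atTop := by
  have hlogh := log_natCast_pos hh
  have hlogd := one_pos.trans_le (one_le_log_two_mul_add_one hh)
  rw [funext (tauStar_two_mul_add_one hh ε)]
  exact (Real.tendsto_log_atTop.comp (tendsto_log_natCast.atTop_div_const hlogd)).const_mul_atTop
    (by positivity)

theorem eventually_mul_log_le_pow_floor_tauStar (K : ℝ) (s₀ : ℕ) :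
    ∀ᶠ t : ℕ in atTop, K * Real.log t ≤ (h : ℝ) ^ (⌊tauStar (2 * h + 1) ε t⌋₊ - s₀) := by
  have hh₀ : (0 : ℝ) < h := Nat.cast_pos.2 (zero_lt_two.trans_le hh)
  have hlogd := one_pos.trans_le (one_le_log_two_mul_add_one hh)
  set D := Real.log (2 * h + 1 : ℕ)
  have hrpow : Tendsto (fun t : ℕ => (Real.log t / D) ^ ε) atTop atTop :=
    (tendsto_rpow_atTop hε).comp (tendsto_log_natCast.atTop_div_const hlogd)
  filter_upwards [tendsto_log_natCast.eventually_gt_atTop 0,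
    hrpow.eventually_ge_atTop (K * D * (h : ℝ) ^ (1 + s₀ : ℝ))] with t hx hK
  set τ := tauStar (2 * h + 1) ε t
  have hpow : (h : ℝ) ^ τ = (Real.log t / D) ^ (1 + ε) := rpow_tauStar hh ε hx
  have hfloor : τ - (1 + s₀) ≤ (⌊τ⌋₊ - s₀ : ℕ) := by
    have : (⌊τ⌋₊ : ℝ) - s₀ ≤ (⌊τ⌋₊ - s₀ : ℕ) := by
      rw [sub_le_iff_le_add]
      exact_mod_cast le_tsub_add
    linarith [Nat.lt_floor_add_one τ]
  calc K * Real.log t = K * D * (h : ℝ) ^ (1 + s₀ : ℝ) * (Real.log t / D)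
          / (h : ℝ) ^ (1 + s₀ : ℝ) := by field_simp
    _ ≤ (Real.log t / D) ^ ε * (Real.log t / D) / (h : ℝ) ^ (1 + s₀ : ℝ) := by gcongr
    _ = (h : ℝ) ^ (τ - (1 + s₀)) := by
        rw [Real.rpow_sub hh₀, hpow, add_comm 1 ε, Real.rpow_add_one (by positivity)]
    _ ≤ (h : ℝ) ^ ((⌊τ⌋₊ - s₀ : ℕ) : ℝ) :=
        Real.rpow_le_rpow_of_exponent_le (Nat.one_le_cast.2 (one_le_two.trans hh)) hfloor
    _ = _ := Real.rpow_natCast _ _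

theorem tendsto_mul_redSeq_floor_tauStar {α : ℝ} (hα₀ : 0 ≤ α) (hα : α < alphaStar (2 * h + 1)) :
    Tendsto (fun t : ℕ => t * redSeq h α ⌊tauStar (2 * h + 1) ε t⌋₊) atTop (𝓝 0) := by
  obtain ⟨s₀, hs₀⟩ := exists_redSeq_le_exp hh hα₀ hα
  refine squeeze_zero' (.of_forall fun t =>
    mul_nonneg t.cast_nonneg (redSeq_mem_Icc hh hα₀ hα _).1) ?_ tendsto_inv_atTop_nhds_zero_nat
  filter_upwards [eventually_mul_log_le_pow_floor_tauStar hh hε 2 s₀, eventually_gt_atTop 0,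
    (tendsto_tauStar hh hε).eventually_ge_atTop (s₀ : ℝ)] with t hpow ht hτ
  have ht' : (0 : ℝ) < t := Nat.cast_pos.2 ht
  have hred : redSeq h α ⌊tauStar (2 * h + 1) ε t⌋₊ ≤ Real.exp (-(2 * Real.log t)) := by
    rw [← Nat.add_sub_of_le (Nat.le_floor hτ)]
    exact (hs₀ _).trans (Real.exp_le_exp.2 (neg_le_neg hpow))
  calc t * redSeq h α ⌊tauStar (2 * h + 1) ε t⌋₊ ≤ t * Real.exp (-(2 * Real.log t)) := by gcongr
    _ = (t : ℝ)⁻¹ := by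
        rw [two_mul, neg_add, Real.exp_add, Real.exp_neg, Real.exp_log ht']
        field_simp

end TauStar

theorem tendsto_jointLaw_not_blueOutsideCore {m k h : ℕ} (hm : 0 < m) (hkodd : Odd k)
    (hd : dParam m k = 2 * h + 1) (hh : 2 ≤ h) {ε A : ℝ} (hε : 0 < ε)
    (hA : 6 * ((1 + ε) / Real.log h + 3) ≤ A) (δ : ℝ≥0) {α : unitInterval}
    (hα : (α : ℝ) < alphaStar (2 * h + 1)) :
    Tendsto (fun t : ℕ => jointLaw m k δ α t {x | ¬ ∀ s ∈ Finset.Icc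
        ⌊tauStar (2 * h + 1) ε t⌋₊ (⌈tauStar (2 * h + 1) ε t⌉₊ + 1),
        BlueOutsideCore A x.1 x.2.1 x.2.2 (s + 1)}) atTop (𝓝 0) := by
  have hlogh := log_natCast_pos hh
  have hC : 0 < 6 * ((1 + ε) / Real.log h + 3) := by positivity
  have hM : ∀ᶠ t : ℕ in atTop, ((6 * (⌈tauStar (2 * h + 1) ε t⌉₊ + 2) : ℕ) : ℝ)
      ≤ 6 * ((1 + ε) / Real.log h + 3) * Real.log (Real.log t) := by
    filter_upwards [tendsto_log_natCast.eventually_gt_atTop 0,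
      tendsto_log_log_natCast.eventually_ge_atTop 1] with t hx hy
    push_cast
    linarith [ceil_tauStar_add_two_le hh hε hx hy]
  have hexcess := tendsto_paTreeLaw_hasExcess (δ / m) m hM (A := A) (by linarith)
  have hred := ENNReal.tendsto_ofReal
    ((tendsto_mul_redSeq_floor_tauStar hh hε α.2.1 hα).const_mul (6 * (m : ℝ)))
  have hlim := hexcess.add hred
  rw [mul_zero, ENNReal.ofReal_zero, add_zero] at hlim
  refine tendsto_of_tendsto_of_tendsto_of_le_of_le tendsto_const_nhds hlim
    (fun t => zero_le) fun t => ?_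
  set τ := tauStar (2 * h + 1) ε t
  refine (jointLaw_not_blueOutsideCore_le hm hkodd hd hh A hα (a := ⌊τ⌋₊)
    (L := ⌈τ⌉₊ + 2) fun s hs => ?_).trans ?_
  · rw [Finset.mem_Icc] at hs
    lia
  · have hcard : ((Finset.Icc ⌊τ⌋₊ (⌈τ⌉₊ + 1)).card : ℝ) ≤ 3 := by
      have := Nat.ceil_le_floor_add_one τ
      rw [Nat.card_Icc]
      exact_mod_cast (by lia : ⌈τ⌉₊ + 1 + 1 - ⌊τ⌋₊ ≤ 3)
    have hnonneg := (redSeq_mem_Icc hh α.2.1 hα ⌊τ⌋₊).1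
    refine add_le_add le_rfl (ENNReal.ofReal_le_ofReal ?_)
    calc _ ≤ 3 * (2 * ((t * m : ℕ) : ℝ)) * redSeq h α ⌊τ⌋₊ := by gcongr
      _ = _ := by
          push_cast
          ring

theorem tendsto_measure_one_of_tendsto_measure_compl {ι : Type*} {Ω : ι → Type*}
    [∀ i, MeasurableSpace (Ω i)] {μ : ∀ i, Measure (Ω i)} [∀ i, IsProbabilityMeasure (μ i)]
    {s : ∀ i, Set (Ω i)} {l : Filter ι} (hs : Tendsto (fun i => μ i (s i)ᶜ) l (𝓝 0)) :
    Tendsto (fun i => μ i (s i)) l (𝓝 1) := by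
  have hlim := ENNReal.Tendsto.sub (tendsto_const_nhds (x := 1)) hs (.inl ENNReal.one_ne_top)
  rw [tsub_zero] at hlim
  refine tendsto_of_tendsto_of_tendsto_of_le_of_le hlim tendsto_const_nhds (fun i => ?_)
    fun i => prob_le_one
  rw [tsub_le_iff_right, ← measure_univ (μ := μ i), ← Set.union_compl_self (s i)]
  exact measure_union_le _ _

end MajorityPA

end

open MajorityPA in
theorem mainTheorem3 (m k : ℕ) (hm : 5 ≤ m) (hk : 5 ≤ k) (hkodd : Odd k)
    (ε : ℝ) (hε : 0 < ε) :
    ∃ A₀ : ℝ, ∀ A : ℝ, A₀ ≤ A →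
      ∀ (δ : ℝ≥0) (α : unitInterval), (α : ℝ) < alphaStar (dParam m k) →
        Tendsto
          (fun t : ℕ => jointLaw m k δ α t
            {x | ∀ T : ℕ, (T = ⌊tauStar (dParam m k) ε t⌋₊ ∨ T = ⌈tauStar (dParam m k) ε t⌉₊) →
              BlueOutsideCore A x.1 x.2.1 x.2.2 (T + 1) ∧
              BlueOutsideCore A x.1 x.2.1 x.2.2 (T + 2)})
          atTop (𝓝 1) := by
  obtain ⟨h, hh, hd⟩ := exists_dParam_eq hm hk hkodd
  refine ⟨6 * ((1 + ε) / Real.log h + 3), fun A hA δ α hα => ?_⟩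
  rw [hd] at hα ⊢
  have hlim := tendsto_jointLaw_not_blueOutsideCore (by lia) hkodd hd hh hε hA δ hα
  refine tendsto_measure_one_of_tendsto_measure_compl
    (tendsto_of_tendsto_of_tendsto_of_le_of_le tendsto_const_nhds hlim (fun t => zero_le)
      fun t => measure_mono ?_)
  intro x hx hblue
  have hfloor_le_ceil := Nat.floor_le_ceil (tauStar (2 * h + 1) ε t)
  refine hx fun T hT => ⟨hblue T (Finset.mem_Icc.2 ?_), hblue (T + 1) (Finset.mem_Icc.2 ?_)⟩
  · lia
  · lia
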